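/- Conventions. All locally convex spaces are real. A map $f\colon U\to F$ from an open subset $U$ of a Hausdorff locally convex space $E$ to a Hausdorff locally convex space $F$ is $C^r$ ($r\in\mathbb N_0\cup\{\infty\}$) if it is continuous and, for all $k\in\mathbb N$ with $k\le r$, the iterated directional derivatives $d^kf(x,y_1,\dots,y_k)=D_{y_1}\cdots D_{y_k}f(x)$ exist for all $x\in U$, $y_i\in E$ and define a continuous map $U\times E^k\to F$. $C^r$-manifolds (Hausdorff, modelled on arbitrary Hausdorff locally convex spaces), $C^r$-maps between them and (smooth) Lie groups are defined as usual from these $C^r$-maps. $E$ is called $C^r$-regular if for each $0$-neighbourhood $U\subseteq E$ there is a $C^r$-function $f\colon E\to\mathbb R$ with $f(0)=1$ and $f|_{E\setminus U}=0$. For a Lie group $G$ we write $L(G)=T_1G$, with its locally convex topology, and $L(f)=T_1f$ for smooth homomorphisms $f$. Let $G=\bigcup_{n\in\mathbb N}G_n$ be a Lie group which is the union of an ascending sequence $G_1\subseteq G_2\subseteq\cdots$ of Lie groups (each with its own Lie group structure) such that all inclusion maps $i_{n,m}\colon G_m\to G_n$ ($n\ge m$) and $i_n\colon G_n\to G$ are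 smooth homomorphisms. Let $E$ and $E_n$ be the modelling spaces of $G$ and $G_n$. Assume that $G$ admits a direct limit chart, that is, there are a chart $\phi\colon U\to V\subseteq E$ of $G$ with $1\in U$, an $n_0\in\mathbb N$, and continuous linear maps $j_{n,m}\colon E_m\to E_n$ ($n\ge m\ge n_0$) and $j_n\colon E_n\to E$ ($n\ge n_0$) such that $((E_n)_{n\ge n_0},(j_{n,m}))$ is a direct system with direct limit $(E,(j_n)_{n\ge n_0})$ in the category of locally convex spaces and continuous linear maps, $E=\bigcup_{n\ge n_0}j_n(E_n)$, and there are charts $\phi_n\colon U_n\to V_n\subseteq E_n$ of $G_n$ ($n\ge n_0$) with $U_m\subseteq U_n$ and $j_{n,m}(V_m)\subseteq V_n$ for $n\ge m\ge n_0$, $U=\bigcup_{n\ge n_0}U_n$, $V=\bigcup_{n\ge n_0}j_n(V_n)$, and $\phi\circ i_n|_{U_n}=j_n|_{V_n}\circ\phi_n$ for all $n\ge n_0$. Then: (a) $(L(G),(L(i_n))_{n})=\varinjlim\,((L(G_n))_n,(L(i_{n,m}))_{n\ge m})$ in the category of topological spaces and continuous maps if and only if $(G,(i_n)_n)=\varinjlim\,((G_n)_n,(i_{n,m})_{n\ge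 m})$ in that category. (b) Let $r\in\mathbb N_0\cup\{\infty\}$. If $L(G)$ is $C^r$-regular, then $(L(G),(L(i_n))_{n})=\varinjlim\,((L(G_n))_n,(L(i_{n,m}))_{n\ge m})$ in the category of $C^r$-manifolds and $C^r$-maps if and only if $(G,(i_n)_n)=\varinjlim\,((G_n)_n,(i_{n,m})_{n\ge m})$ in that category. -/

import Mathlib

open Set Filter Topology

universe u

namespace LCLie

noncomputable section

/-! ### Calculus in real locally convex spaces -/

section Calculus

variable {E : Type*} [AddCommGroup E] [Module ℝ E] [TopologicalSpace E]
variable {F : Type*} [AddCommGroup F] [Module ℝ F] [TopologicalSpace F]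

/-- The directional derivative `D_v f (x) = lim_{t → 0} t⁻¹ (f (x + t v) - f x)` exists and equals
`f'`. -/
def HasDirDeriv (f : E → F) (x v : E) (f' : F) : Prop :=
  Tendsto (fun t : ℝ => t⁻¹ • (f (x + t • v) - f x)) (𝓝[≠] 0) (𝓝 f')

/-- The directional derivative `D_v f (x)`, meaningful whenever it exists (in a Hausdorff `F`). -/
def dirDeriv (f : E → F) (x v : E) : F :=
  limUnder (𝓝[≠] (0 : ℝ)) (fun t : ℝ => t⁻¹ • (f (x + t • v) - f x))

/-- `f` is `C^r` (Keller's `C^r_c`, `r ∈ ℕ₀ ∪ {∞}`) on the open set `U`: it is continuous on `U`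
and for all `k ≤ r` the iterated directional derivatives
`d^k f (x, y₁, …, y_k) = D_{y₁} ⋯ D_{y_k} f (x)` exist for `x ∈ U` and define a continuous map
`U × E^k → F`. Here `d k x y` is `d^k f (x, y₁, …, y_k)`; it is unique for `x ∈ U`, `k ≤ r`, if `F`
is Hausdorff and `U` is open. -/
def IsCrOn (r : ℕ∞) (f : E → F) (U : Set E) : Prop :=
  ∃ d : (k : ℕ) → E → (Fin k → E) → F,
    (∀ x ∈ U, ∀ y : Fin 0 → E, d 0 x y = f x) ∧
    (∀ k : ℕ, ((k + 1 : ℕ) : ℕ∞) ≤ r → ∀ x ∈ U, ∀ (v : E) (y : Fin k → E),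
      HasDirDeriv (fun z => d k z y) x v (d (k + 1) x (Fin.cons v y : Fin (k + 1) → E))) ∧
    (∀ k : ℕ, (k : ℕ∞) ≤ r →
      ContinuousOn (fun p : E × (Fin k → E) => d k p.1 p.2) (U ×ˢ univ))

variable (E) in
/-- `E` is `C^r`-regular: for each `0`-neighbourhood `U` there is a `C^r`-function `f : E → ℝ` with
`f 0 = 1` and `f = 0` outside `U`. -/
def IsCrRegular (r : ℕ∞) : Prop :=
  ∀ U ∈ 𝓝 (0 : E), ∃ f : E → ℝ, IsCrOn r f univ ∧ f 0 = 1 ∧ ∀ x ∉ U, f x = 0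

end Calculus

/-! ### Manifolds modelled on locally convex spaces -/

section Manifolds

variable (E : Type*) [AddCommGroup E] [Module ℝ E] [TopologicalSpace E]
variable (F : Type*) [AddCommGroup F] [Module ℝ F] [TopologicalSpace F]

/-- The Hausdorff space `M` with its atlas of charts in `E` is a `C^r`-manifold: all changes of
charts are `C^r`. -/
structure IsCrManifold (r : ℕ∞) (M : Type*) [TopologicalSpace M] [ChartedSpace E M] : Prop where
  t2 : T2Space M
  compatible : ∀ e ∈ atlas E M, ∀ e' ∈ atlas E M,
    IsCrOn r (e' ∘ e.symm) (e.symm.trans e').source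

variable {E} in
/-- `φ` is a chart of the `C^r`-manifold `M`, i.e. it belongs to the maximal `C^r`-atlas. -/
def IsCrChart (r : ℕ∞) {M : Type*} [TopologicalSpace M] [ChartedSpace E M]
    (φ : OpenPartialHomeomorph M E) : Prop :=
  ∀ e ∈ atlas E M, IsCrOn r (φ ∘ e.symm) (e.symm.trans φ).source ∧
    IsCrOn r (e ∘ φ.symm) (φ.symm.trans e).source

/-- `f : M → N` is a `C^r`-map between manifolds modelled on `E` and `F`: it is continuous, and it
is `C^r` in all charts. -/
def IsCrMap (r : ℕ∞) {M : Type*} [TopologicalSpace M] [ChartedSpace E M]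
    {N : Type*} [TopologicalSpace N] [ChartedSpace F N] (f : M → N) : Prop :=
  Continuous f ∧ ∀ e ∈ atlas E M, ∀ e' ∈ atlas F N,
    IsCrOn r (e' ∘ f ∘ e.symm) (e.target ∩ e.symm ⁻¹' (f ⁻¹' e'.source))

/-- The group `G` with its atlas of charts in `E` is a (smooth, real) Lie group modelled on `E`. -/
structure IsLieGroup (G : Type*) [Group G] [TopologicalSpace G] [ChartedSpace E G] : Prop where
  isManifold : IsCrManifold E ⊤ G
  smooth_inv : IsCrMap E E ⊤ (fun g : G => g⁻¹)
  smooth_mul :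
    letI : ChartedSpace (E × E) (G × G) := prodChartedSpace E G E G
    IsCrMap (E × E) E ⊤ (fun p : G × G => p.1 * p.2)

/-- The topological vector space underlying the Lie algebra `L(G) = T_1 G`, where `T_1 G` is
identified with the modelling space by means of the preferred chart at `1`. -/
abbrev LieAlg (G : Type*) [Group G] [TopologicalSpace G] [ChartedSpace E G] : Type _ :=
  E

/-- The map `L(f) = T_1 f : L(G) → L(H)` for a smooth homomorphism `f : G → H`: the derivative at
`1` of `f` expressed in the preferred charts at `1`. -/
def lieMap {G : Type*} [Group G] [TopologicalSpace G] [ChartedSpace E G]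
    {H : Type*} [Group H] [TopologicalSpace H] [ChartedSpace F H] (f : G →* H) :
    LieAlg E G → LieAlg F H :=
  fun v => dirDeriv (chartAt F (1 : H) ∘ f ∘ (chartAt E (1 : G)).symm) (chartAt E (1 : G) 1) v

end Manifolds

/-! ### Direct limits -/

section DirectLimits

variable {I : Type*} [Preorder I]

/-- `(Y, ι) = lim (X, b)` in the category of topological spaces and continuous maps. -/
structure IsDirectLimitTop {X : I → Type u} [∀ n, TopologicalSpace (X n)]
    (b : ∀ ⦃m n : I⦄, m ≤ n → X m → X n)
    {Y : Type u} [TopologicalSpace Y] (ι : ∀ n, X n → Y) : Prop where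
  directedSystem : DirectedSystem X b
  continuous_bond : ∀ ⦃m n : I⦄ (h : m ≤ n), Continuous (b h)
  continuous_cone : ∀ n, Continuous (ι n)
  cone : ∀ ⦃m n : I⦄ (h : m ≤ n) (x : X m), ι n (b h x) = ι m x
  universal : ∀ (Z : Type u) [TopologicalSpace Z] (ψ : ∀ n, X n → Z),
    (∀ n, Continuous (ψ n)) →
    (∀ ⦃m n : I⦄ (h : m ≤ n) (x : X m), ψ n (b h x) = ψ m x) →
    ∃! f : Y → Z, Continuous f ∧ ∀ n x, f (ι n x) = ψ n x

/-- `(Y, ι) = lim (X, b)` in the category of `C^r`-manifolds (modelled on arbitrary Hausdorff real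
locally convex spaces) and `C^r`-maps; `X n` is modelled on `En n` and `Y` on `E`. -/
structure IsDirectLimitMfd (r : ℕ∞) (En : I → Type u) [∀ n, AddCommGroup (En n)]
    [∀ n, Module ℝ (En n)] [∀ n, TopologicalSpace (En n)]
    (E : Type u) [AddCommGroup E] [Module ℝ E] [TopologicalSpace E]
    {X : I → Type u} [∀ n, TopologicalSpace (X n)] [∀ n, ChartedSpace (En n) (X n)]
    (b : ∀ ⦃m n : I⦄, m ≤ n → X m → X n)
    {Y : Type u} [TopologicalSpace Y] [ChartedSpace E Y] (ι : ∀ n, X n → Y) : Prop where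
  directedSystem : DirectedSystem X b
  isCrMap_bond : ∀ ⦃m n : I⦄ (h : m ≤ n), IsCrMap (En m) (En n) r (b h)
  isCrMap_cone : ∀ n, IsCrMap (En n) E r (ι n)
  cone : ∀ ⦃m n : I⦄ (h : m ≤ n) (x : X m), ι n (b h x) = ι m x
  universal : ∀ (F : Type u) [AddCommGroup F] [Module ℝ F] [TopologicalSpace F]
    [IsTopologicalAddGroup F] [ContinuousSMul ℝ F] [LocallyConvexSpace ℝ F] [T2Space F]
    (Z : Type u) [TopologicalSpace Z] [ChartedSpace F Z],
    IsCrManifold F r Z → ∀ ψ : ∀ n, X n → Z,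
    (∀ n, IsCrMap (En n) F r (ψ n)) →
    (∀ ⦃m n : I⦄ (h : m ≤ n) (x : X m), ψ n (b h x) = ψ m x) →
    ∃! f : Y → Z, IsCrMap E F r f ∧ ∀ n x, f (ι n x) = ψ n x

/-- `(E, j) = lim (X, b)` in the category of (not necessarily Hausdorff) real locally convex spaces
and continuous linear maps. -/
structure IsDirectLimitLCS {X : I → Type u} [∀ n, AddCommGroup (X n)]
    [∀ n, Module ℝ (X n)] [∀ n, TopologicalSpace (X n)]
    (b : ∀ ⦃m n : I⦄, m ≤ n → X m →L[ℝ] X n)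
    {E : Type u} [AddCommGroup E] [Module ℝ E] [TopologicalSpace E]
    (j : ∀ n, X n →L[ℝ] E) : Prop where
  directedSystem : DirectedSystem X (fun _ _ h => b h)
  cone : ∀ ⦃m n : I⦄ (h : m ≤ n) (x : X m), j n (b h x) = j m x
  universal : ∀ (F : Type u) [AddCommGroup F] [Module ℝ F] [TopologicalSpace F]
    [IsTopologicalAddGroup F] [ContinuousSMul ℝ F] [LocallyConvexSpace ℝ F]
    (ψ : ∀ n, X n →L[ℝ] F),
    (∀ ⦃m n : I⦄ (h : m ≤ n) (x : X m), ψ n (b h x) = ψ m x) →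
    ∃! f : E →L[ℝ] F, ∀ n x, f (j n x) = ψ n x

end DirectLimits

/-! ### Ascending unions of Lie groups and direct limit charts -/

section Unions

variable (En : ℕ → Type u) [∀ n, AddCommGroup (En n)] [∀ n, Module ℝ (En n)]
  [∀ n, TopologicalSpace (En n)]
  (E : Type u) [AddCommGroup E] [Module ℝ E] [TopologicalSpace E]
  {Gn : ℕ → Type u} [∀ n, Group (Gn n)] [∀ n, TopologicalSpace (Gn n)]
  [∀ n, ChartedSpace (En n) (Gn n)]
  {G : Type u} [Group G] [TopologicalSpace G] [ChartedSpace E G]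

/-- `G = ⋃ₙ Gₙ` for an ascending sequence of Lie groups (each with its own Lie group structure, not
necessarily the induced one), such that the inclusion maps `b h : G_m → G_n` (for `m ≤ n`) and
`ι n : G_n → G` are smooth homomorphisms. -/
structure IsAscendingUnion (b : ∀ ⦃m n : ℕ⦄, m ≤ n → Gn m →* Gn n) (ι : ∀ n, Gn n →* G) :
    Prop where
  isLieGroup : IsLieGroup E G
  isLieGroup_step : ∀ n, IsLieGroup (En n) (Gn n)
  injective : ∀ n, Function.Injective (ι n)
  comp : ∀ ⦃m n : ℕ⦄ (h : m ≤ n) (x : Gn m), ι n (b h x) = ι m x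
  exhaust : ∀ g : G, ∃ n, ∃ x : Gn n, ι n x = g
  smooth_bond : ∀ ⦃m n : ℕ⦄ (h : m ≤ n), IsCrMap (En m) (En n) ⊤ (b h)
  smooth_incl : ∀ n, IsCrMap (En n) E ⊤ (ι n)

variable {En E}

/-- The chart `φ : U → V ⊆ E` of `G = ⋃ₙ Gₙ` is a direct limit chart: for some `n₀`, the space `E`
is the locally convex direct limit of the modelling spaces `E_n` (`n ≥ n₀`) along suitable
continuous linear maps, it is the union of their images, and `φ` is the union of compatible
charts `φ_n : U_n → V_n ⊆ E_n` of `G_n`. -/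
def IsDirectLimitChart (b : ∀ ⦃m n : ℕ⦄, m ≤ n → Gn m →* Gn n) (ι : ∀ n, Gn n →* G)
    (φ : OpenPartialHomeomorph G E) : Prop :=
  IsCrChart ⊤ φ ∧
  ∃ (n₀ : ℕ) (jb : ∀ ⦃m n : Ici n₀⦄, m ≤ n → En m →L[ℝ] En n) (j : ∀ n : Ici n₀, En n →L[ℝ] E)
    (φn : ∀ n : Ici n₀, OpenPartialHomeomorph (Gn n) (En n)),
    IsDirectLimitLCS (X := fun n : Ici n₀ => En n) jb j ∧
    (∀ v : E, ∃ n, ∃ w, j n w = v) ∧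
    (∀ n, IsCrChart ⊤ (φn n)) ∧
    (∀ ⦃m n : Ici n₀⦄ (h : m ≤ n), MapsTo (b h) (φn m).source (φn n).source) ∧
    (∀ ⦃m n : Ici n₀⦄ (h : m ≤ n), MapsTo (jb h) (φn m).target (φn n).target) ∧
    φ.source = ⋃ n : Ici n₀, ι n '' (φn n).source ∧
    φ.target = ⋃ n : Ici n₀, j n '' (φn n).target ∧
    (∀ n, ∀ x ∈ (φn n).source, φ (ι n x) = j n (φn n x))

/-- The Lie group `G = ⋃ₙ Gₙ` has a direct limit chart around `1`. -/
def AdmitsDirectLimitChart (b : ∀ ⦃m n : ℕ⦄, m ≤ n → Gn m →* Gn n) (ι : ∀ n, Gn n →* G) :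
    Prop :=
  ∃ φ : OpenPartialHomeomorph G E, (1 : G) ∈ φ.source ∧ IsDirectLimitChart (En := En) b ι φ

end Unions

end

end LCLie

namespace LCLie

set_option linter.unusedSectionVars false

noncomputable section

/-! ### Mean value estimates and first order calculus -/

section FirstOrder

variable {E : Type*} [AddCommGroup E] [Module ℝ E] [TopologicalSpace E]
variable {F : Type*} [AddCommGroup F] [Module ℝ F] [TopologicalSpace F]
variable {H : Type*} [AddCommGroup H] [Module ℝ H] [TopologicalSpace H]

/-! Both `G` and `L(G)` are direct limits on the level of sets, so a compatible family of maps into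
`Z` always induces a unique map `f`. The only question is whether `f` is continuous, or `C^r`, and
this can be checked near one point at a time.

After an affine change, the direct limit chart satisfies `φ 1 = 0` and `φ ∘ ι_n = L(ι_n) ∘ φ_n`
(`exists_adaptedCharts`). It identifies the two direct systems only locally, whereas the universal
property of a limit needs globally defined maps. A cut-off `χ` bridges the gap: near any point, the
limit to be tested is a retract of the limit already known (`LocallyFactors`).

To test `f` near `g ∈ G`, take `Θ v = g * φ⁻¹ (χ v • v)`, defined on all of `L(G)`, and `T y = φ
(g⁻¹ y)`. Then `Θ ∘ T` is the identity near `g`. On the steps, `Θ` lifts locally to `C^r`-maps into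
some `G_m`, so `f ∘ Θ` is `C^r` on every step, hence `C^r` on `L(G)`, and `f = (f ∘ Θ) ∘ T` near
`g`. To test near `v₀ ∈ L(G)`, use `Θ y = v₀ + χ (φ y) • φ y`, extended by `v₀`, and `T v = φ⁻¹ (v -
v₀)`. The two constructions are `locallyFactors_group` and `locallyFactors_lieAlg`; the transfer is
`LocallyFactors.isDirectLimitTop` and `LocallyFactors.isDirectLimitMfd`. Part (a) uses `r = 0`,
where cut-offs exist by complete regularity.

The preliminary calculus rests on a mean value estimate, and on the equivalence `isCrOn_iff_recCr`
of iterated directional derivatives with a recursive notion of `C^n`, for which the chain rule is a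
short induction. -/

theorem HasDirDeriv.unique [T2Space F] {f : E → F} {x v : E} {a a' : F}
    (h : HasDirDeriv f x v a) (h' : HasDirDeriv f x v a') : a = a' :=
  tendsto_nhds_unique h h'

theorem HasDirDeriv.dirDeriv_eq [T2Space F] {f : E → F} {x v : E} {a : F}
    (h : HasDirDeriv f x v a) : dirDeriv f x v = a :=
  Tendsto.limUnder_eq h

theorem tendsto_add_smul_nhds [IsTopologicalAddGroup E] [ContinuousSMul ℝ E] (x v : E) :
    Tendsto (fun t : ℝ => x + t • v) (𝓝[≠] 0) (𝓝 x) := by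
  have h : Continuous (fun t : ℝ => x + t • v) := by fun_prop
  simpa using (h.tendsto 0).mono_left nhdsWithin_le_nhds

theorem HasDirDeriv.congr_of_eventuallyEq [IsTopologicalAddGroup E] [ContinuousSMul ℝ E]
    {f g : E → F} {x v : E} {a : F} (h : HasDirDeriv f x v a) (hfg : f =ᶠ[𝓝 x] g) :
    HasDirDeriv g x v a := by
  refine Tendsto.congr' ?_ h
  filter_upwards [(tendsto_add_smul_nhds x v).eventually hfg] with t ht
  rw [ht, hfg.self_of_nhds]

theorem HasDirDeriv.congr_of_eqOn [IsTopologicalAddGroup E] [ContinuousSMul ℝ E]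
    {f g : E → F} {x v : E} {a : F} (h : HasDirDeriv f x v a) {U : Set E} (hU : IsOpen U)
    (hx : x ∈ U) (hfg : EqOn f g U) : HasDirDeriv g x v a :=
  h.congr_of_eventuallyEq (hfg.eventuallyEq_of_mem (hU.mem_nhds hx))

theorem HasDirDeriv.const [IsTopologicalAddGroup F] [ContinuousSMul ℝ F] (c : F) (x v : E) :
    HasDirDeriv (fun _ : E => c) x v 0 := by
  simpa [HasDirDeriv] using tendsto_const_nhds

theorem HasDirDeriv.clm (L : E →L[ℝ] F) (x v : E) : HasDirDeriv L x v (L v) := by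
  refine Tendsto.congr' ?_ tendsto_const_nhds
  filter_upwards [self_mem_nhdsWithin] with t ht
  have ht : t ≠ 0 := ht
  simp [smul_smul, ht]

theorem HasDirDeriv.clm_comp (L : F →L[ℝ] H) {f : E → F} {x v : E} {a : F}
    (h : HasDirDeriv f x v a) : HasDirDeriv (fun z => L (f z)) x v (L a) := by
  refine ((L.continuous.tendsto a).comp h).congr fun t => ?_
  simp

theorem HasDirDeriv.add [IsTopologicalAddGroup F] {f g : E → F} {x v : E} {a a' : F}
    (h : HasDirDeriv f x v a) (h' : HasDirDeriv g x v a') :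
    HasDirDeriv (fun z => f z + g z) x v (a + a') := by
  refine (Tendsto.add h h').congr fun t => ?_
  simp only [← smul_add]
  congr 1
  abel

theorem HasDirDeriv.const_smul [ContinuousSMul ℝ F] {f : E → F} {x v : E} {a : F} (c : ℝ)
    (h : HasDirDeriv f x v a) : HasDirDeriv (fun z => c • f z) x v (c • a) := by
  refine (Tendsto.const_smul h c).congr fun t => ?_
  rw [smul_comm, smul_sub]

theorem HasDirDeriv.tendsto [IsTopologicalAddGroup F] [ContinuousSMul ℝ F] {f : E → F} {x v : E}
    {a : F} (h : HasDirDeriv f x v a) :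
    Tendsto (fun t : ℝ => f (x + t • v)) (𝓝[≠] 0) (𝓝 (f x)) := by
  have h0 : Tendsto (fun t : ℝ => t) (𝓝[≠] 0) (𝓝 0) := nhdsWithin_le_nhds
  have := (h0.smul h).add_const (f x)
  rw [zero_smul, zero_add] at this
  refine this.congr' ?_
  filter_upwards [self_mem_nhdsWithin] with t ht
  have ht : t ≠ 0 := ht
  simp [smul_smul, ht]

theorem HasDirDeriv.smul [IsTopologicalAddGroup F] [ContinuousSMul ℝ F] {c : E → ℝ} {f : E → F}
    {x v : E} {c' : ℝ} {a : F} (hc : HasDirDeriv c x v c') (hf : HasDirDeriv f x v a) :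
    HasDirDeriv (fun z => c z • f z) x v (c x • a + c' • f x) := by
  have := (Tendsto.const_smul hf (c x)).add (Tendsto.smul hc hf.tendsto)
  refine this.congr fun t => ?_
  simp only [smul_sub, smul_smul, smul_eq_mul, sub_smul, mul_comm (c x), mul_sub]
  abel

theorem HasDirDeriv.prodMk {f : E → F} {g : E → H} {x v : E} {a : F} {a' : H}
    (h : HasDirDeriv f x v a) (h' : HasDirDeriv g x v a') :
    HasDirDeriv (fun z => (f z, g z)) x v (a, a') :=
  Tendsto.prodMk_nhds h h'

theorem HasDirDeriv.smul_dir [ContinuousSMul ℝ F] [IsTopologicalAddGroup F] {f : E → F} {x v : E}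
    {a : F} (c : ℝ) (h : HasDirDeriv f x v a) : HasDirDeriv f x (c • v) (c • a) := by
  rcases eq_or_ne c 0 with rfl | hc
  · simpa [HasDirDeriv] using tendsto_const_nhds
  have h1 : Tendsto (fun t : ℝ => t * c) (𝓝[≠] 0) (𝓝[≠] 0) := by
    refine tendsto_nhdsWithin_of_tendsto_nhds_of_eventually_within _ ?_ ?_
    · have : Continuous (fun t : ℝ => t * c) := by fun_prop
      simpa using (this.tendsto 0).mono_left nhdsWithin_le_nhds
    · filter_upwards [self_mem_nhdsWithin] with t ht
      exact mul_ne_zero ht hc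
  refine ((h.comp h1).const_smul c).congr' ?_
  filter_upwards [self_mem_nhdsWithin] with t ht
  have ht : t ≠ 0 := ht
  simp only [Function.comp_apply, smul_smul]
  congr 1
  field_simp

/-- A `C^1`-curve on `[0, 1]` has its increment in each closed convex set which contains all of its
velocities. -/
theorem sub_mem_of_hasDirDeriv [IsTopologicalAddGroup F] [ContinuousSMul ℝ F]
    [LocallyConvexSpace ℝ F] {γ γ' : ℝ → F} {K : Set F} (hK : Convex ℝ K) (hKc : IsClosed K)
    (hγ : ∀ s ∈ Icc (0 : ℝ) 1, HasDirDeriv γ s (1 : ℝ) (γ' s))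
    (hmem : ∀ s ∈ Icc (0 : ℝ) 1, γ' s ∈ K) : γ 1 - γ 0 ∈ K := by
  by_contra hn
  -- A separating continuous functional reduces the claim to the scalar mean value theorem; no
  -- integral, hence no completeness of `F`, is needed.
  obtain ⟨l, c, hl, hc⟩ := geometric_hahn_banach_closed_point hK hKc hn
  have hd : ∀ s ∈ Icc (0 : ℝ) 1, HasDerivAt (fun s => l (γ s)) (l (γ' s)) s := by
    intro s hs
    rw [hasDerivAt_iff_tendsto_slope_zero]
    simpa [HasDirDeriv] using (hγ s hs).clm_comp l
  obtain ⟨s, hs, hs'⟩ := exists_hasDerivAt_eq_slope (fun s => l (γ s)) (fun s => l (γ' s))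
    one_pos (fun s hs => (hd s hs).continuousAt.continuousWithinAt)
    (fun s hs => hd s (Ioo_subset_Icc_self hs))
  have := hl _ (hmem s (Ioo_subset_Icc_self hs))
  simp only [sub_zero, div_one, ← map_sub] at hs'
  linarith

theorem exists_isClosed_convex_nhds [IsTopologicalAddGroup F] [ContinuousSMul ℝ F]
    [LocallyConvexSpace ℝ F] {a : F} {W : Set F} (hW : W ∈ 𝓝 a) :
    ∃ K ∈ 𝓝 a, IsClosed K ∧ Convex ℝ K ∧ K ⊆ W := by
  obtain ⟨C, ⟨hC, hCc⟩, hCW⟩ := (closed_nhds_basis a).mem_iff.1 hW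
  obtain ⟨S, ⟨hS, hSc⟩, hSC⟩ := (LocallyConvexSpace.convex_basis (𝕜 := ℝ) a).mem_iff.1 hC
  exact ⟨closure S, mem_of_superset hS subset_closure, isClosed_closure, hSc.closure,
    (closure_minimal hSC hCc).trans hCW⟩

/-- A closed convex neighbourhood of `L` eventually contains all velocities, hence the increment.
The filter `l ×ˢ 𝓟 (Icc 0 1)` expresses uniformity in the curve parameter. -/
theorem tendsto_sub_of_hasDirDeriv [IsTopologicalAddGroup F] [ContinuousSMul ℝ F]
    [LocallyConvexSpace ℝ F] {A : Type*} {l : Filter A} {γ γ' : A → ℝ → F} {L : F}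
    (hγ : ∀ᶠ a in l, ∀ s ∈ Icc (0 : ℝ) 1, HasDirDeriv (γ a) s (1 : ℝ) (γ' a s))
    (hlim : Tendsto (fun p : A × ℝ => γ' p.1 p.2) (l ×ˢ 𝓟 (Icc 0 1)) (𝓝 L)) :
    Tendsto (fun a => γ a 1 - γ a 0) l (𝓝 L) := by
  intro W hW
  obtain ⟨K, hK, hKc, hKconv, hKW⟩ := exists_isClosed_convex_nhds hW
  have h := eventually_prod_principal_iff.1 (hlim.eventually hK)
  refine (hγ.and h).mono fun a ⟨h1, h2⟩ => ?_
  exact hKW (sub_mem_of_hasDirDeriv hKconv hKc h1 h2)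

/-- Difference quotients converge if the derivatives converge uniformly along the segments. -/
theorem tendsto_quotient [IsTopologicalAddGroup F] [ContinuousSMul ℝ F]
    [LocallyConvexSpace ℝ F] {A : Type*} {l : Filter A} {f : A → E → F} {x v : A → E} {t : A → ℝ}
    {f' : A → ℝ → F} {L : F} (ht : ∀ᶠ a in l, t a ≠ 0)
    (hd : ∀ᶠ a in l, ∀ s ∈ Icc (0 : ℝ) 1,
      HasDirDeriv (f a) (x a + (s * t a) • v a) (v a) (f' a s))
    (hlim : Tendsto (fun p : A × ℝ => f' p.1 p.2) (l ×ˢ 𝓟 (Icc 0 1)) (𝓝 L)) :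
    Tendsto (fun a => (t a)⁻¹ • (f a (x a + t a • v a) - f a (x a))) l (𝓝 L) := by
  -- The rescaled curve has the difference quotient as its increment over `[0, 1]` and `f' a` as its
  -- velocity.
  have key := tendsto_sub_of_hasDirDeriv (l := l)
    (γ := fun a s => (t a)⁻¹ • f a (x a + (s * t a) • v a)) (γ' := f') (L := L) ?_ hlim
  · refine key.congr fun a => ?_
    rw [one_mul, zero_mul, zero_smul, add_zero, smul_sub]
  filter_upwards [ht, hd] with a ha h s hs
  have := ((h s hs).smul_dir (t a)).const_smul (t a)⁻¹
  rw [inv_smul_smul₀ ha] at this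
  refine Tendsto.congr (fun r => ?_) this
  have e : x a + ((s + r • (1 : ℝ)) * t a) • v a = x a + (s * t a) • v a + r • (t a • v a) := by
    rw [add_assoc, smul_smul, ← add_smul, smul_eq_mul, mul_one, add_mul]
  simp only [e]

theorem tendsto_segment [IsTopologicalAddGroup E] [ContinuousSMul ℝ E] {A : Type*} {l : Filter A}
    {x v : A → E} {t : A → ℝ} {x₀ v₀ : E} (hx : Tendsto x l (𝓝 x₀)) (hv : Tendsto v l (𝓝 v₀))
    (ht : Tendsto t l (𝓝 0)) :
    Tendsto (fun p : A × ℝ => x p.1 + (p.2 * t p.1) • v p.1) (l ×ˢ 𝓟 (Icc 0 1)) (𝓝 x₀) := by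
  have h1 : Tendsto (fun p : A × ℝ => p.2 * t p.1) (l ×ˢ 𝓟 (Icc (0 : ℝ) 1)) (𝓝 0) := by
    refine squeeze_zero_norm' ?_ (tendsto_zero_iff_norm_tendsto_zero.1 (ht.comp tendsto_fst))
    rw [eventually_prod_principal_iff]
    refine Eventually.of_forall fun a s hs => ?_
    simp only [norm_mul, Function.comp_apply, Real.norm_eq_abs, abs_of_nonneg hs.1]
    exact mul_le_of_le_one_left (abs_nonneg _) hs.2
  simpa using (hx.comp tendsto_fst).add (h1.smul (hv.comp tendsto_fst))

/-- Joint version of the difference quotient of a `C^1`-map. -/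
theorem tendsto_quotient_of_continuousAt [IsTopologicalAddGroup E] [ContinuousSMul ℝ E]
    [IsTopologicalAddGroup F] [ContinuousSMul ℝ F]
    [LocallyConvexSpace ℝ F] {A : Type*} {l : Filter A} {f : E → F} {U : Set E} (hU : IsOpen U)
    {df : E × E → F} (hd : ∀ x ∈ U, ∀ v, HasDirDeriv f x v (df (x, v)))
    {x v : A → E} {t : A → ℝ} {x₀ v₀ : E} (hx₀ : x₀ ∈ U) (hdf : ContinuousAt df (x₀, v₀))
    (hx : Tendsto x l (𝓝 x₀)) (hv : Tendsto v l (𝓝 v₀)) (ht : Tendsto t l (𝓝[≠] 0)) :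
    Tendsto (fun a => (t a)⁻¹ • (f (x a + t a • v a) - f (x a))) l (𝓝 (df (x₀, v₀))) := by
  have hseg := tendsto_segment hx hv (ht.mono_right nhdsWithin_le_nhds)
  refine tendsto_quotient (f := fun _ => f)
    (f' := fun a s => df (x a + (s * t a) • v a, v a)) (ht.eventually self_mem_nhdsWithin) ?_ ?_
  · filter_upwards [eventually_prod_principal_iff.1 (hseg.eventually (hU.mem_nhds hx₀))]
      with a ha s hs using hd _ (ha s hs) _
  · exact hdf.tendsto.comp (hseg.prodMk_nhds (hv.comp tendsto_fst))

/-- First order chain rule. -/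
theorem HasDirDeriv.comp_of_continuousAt [IsTopologicalAddGroup E] [ContinuousSMul ℝ E]
    [IsTopologicalAddGroup F] [ContinuousSMul ℝ F]
    [IsTopologicalAddGroup H] [ContinuousSMul ℝ H]
    [LocallyConvexSpace ℝ H] {f : E → F} {g : F → H} {x v : E} {f' : F}
    (hf : HasDirDeriv f x v f') {V : Set F} (hV : IsOpen V)
    {dg : F × F → H} (hg : ∀ y ∈ V, ∀ w, HasDirDeriv g y w (dg (y, w))) (hx : f x ∈ V)
    (hdg : ContinuousAt dg (f x, f')) : HasDirDeriv (g ∘ f) x v (dg (f x, f')) := by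
  have := tendsto_quotient_of_continuousAt hV hg hx hdg (l := 𝓝[≠] (0 : ℝ)) (t := id)
    (x := fun _ => f x) tendsto_const_nhds hf tendsto_id
  refine this.congr' ?_
  filter_upwards [self_mem_nhdsWithin] with t ht
  have ht : t ≠ 0 := ht
  simp [smul_smul, ht]

/-- The directional derivative of a `C^1`-map is additive in the direction. -/
theorem HasDirDeriv.add_dir [IsTopologicalAddGroup E] [ContinuousSMul ℝ E]
    [IsTopologicalAddGroup F] [ContinuousSMul ℝ F]
    [LocallyConvexSpace ℝ F] {f : E → F} {U : Set E} (hU : IsOpen U)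
    {df : E × E → F} (hd : ∀ x ∈ U, ∀ v, HasDirDeriv f x v (df (x, v)))
    {x v w : E} (hx : x ∈ U) (hdf : ContinuousAt df (x, w)) :
    HasDirDeriv f x (v + w) (df (x, v) + df (x, w)) := by
  -- Go from `x` to `x + t v`, then on to `x + t v + t w`; the second quotient has a moving base
  -- point, which the joint version allows.
  have h1 := tendsto_quotient_of_continuousAt hU hd hx hdf (l := 𝓝[≠] (0 : ℝ)) (t := id)
    (x := fun t : ℝ => x + t • v) (tendsto_add_smul_nhds x v) tendsto_const_nhds tendsto_id
  refine (Tendsto.add (hd x hx v) h1).congr fun t => ?_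
  simp only [id]
  rw [← smul_add, smul_add t v w, ← add_assoc x]
  congr 1
  abel

end FirstOrder

/-! ### Recursive description of `C^n`-maps -/

section Recursive

variable {E : Type*} [AddCommGroup E] [Module ℝ E] [TopologicalSpace E]
variable {F : Type*} [AddCommGroup F] [Module ℝ F] [TopologicalSpace F]
variable {H : Type*} [AddCommGroup H] [Module ℝ H] [TopologicalSpace H]

/-- `C^n`-maps, defined recursively: `f` is `C^{n+1}` if it is continuous and has a differential
`U × E → F` which is `C^n`. -/
def RecCr {F : Type*} [AddCommGroup F] [Module ℝ F] [TopologicalSpace F] :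
    ℕ → ∀ {E : Type u} [AddCommGroup E] [Module ℝ E] [TopologicalSpace E], (E → F) → Set E → Prop
  | 0, _, _, _, _, f, U => ContinuousOn f U
  | n + 1, E, _, _, _, f, U => ContinuousOn f U ∧ ∃ df : E × E → F,
      (∀ x ∈ U, ∀ v, HasDirDeriv f x v (df (x, v))) ∧ RecCr n df (U ×ˢ univ)

theorem RecCr.continuousOn {n : ℕ} {f : E → F} {U : Set E} (h : RecCr n f U) :
    ContinuousOn f U := by
  cases n with
  | zero => exact h
  | succ n => exact h.1

theorem RecCr.of_succ {E : Type u} [AddCommGroup E] [Module ℝ E] [TopologicalSpace E]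
    {n : ℕ} {f : E → F} {U : Set E} (h : RecCr (n + 1) f U) : RecCr n f U := by
  induction n generalizing E with
  | zero => exact h.1
  | succ n ih =>
    obtain ⟨hc, df, hd, hdf⟩ := h
    exact ⟨hc, df, hd, ih hdf⟩

theorem RecCr.mono {E : Type u} [AddCommGroup E] [Module ℝ E] [TopologicalSpace E]
    {n : ℕ} {f : E → F} {U V : Set E} (h : RecCr n f U) (hV : V ⊆ U) : RecCr n f V := by
  induction n generalizing E with
  | zero => exact ContinuousOn.mono h hV
  | succ n ih =>
    obtain ⟨hc, df, hd, hdf⟩ := h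
    exact ⟨hc.mono hV, df, fun x hx => hd x (hV hx), ih hdf (prod_mono_left hV)⟩

theorem RecCr.congr {E : Type u} [AddCommGroup E] [Module ℝ E] [TopologicalSpace E]
    [IsTopologicalAddGroup E] [ContinuousSMul ℝ E]
    {n : ℕ} {f g : E → F} {U : Set E} (h : RecCr n f U) (hU : IsOpen U) (hfg : EqOn f g U) :
    RecCr n g U := by
  cases n with
  | zero => exact ContinuousOn.congr h hfg.symm
  | succ n =>
    obtain ⟨hc, df, hd, hdf⟩ := h
    exact ⟨hc.congr hfg.symm, df, fun x hx v => (hd x hx v).congr_of_eqOn hU hx hfg, hdf⟩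

theorem RecCr.const [IsTopologicalAddGroup F] [ContinuousSMul ℝ F]
    {E : Type u} [AddCommGroup E] [Module ℝ E] [TopologicalSpace E]
    (n : ℕ) (c : F) (U : Set E) : RecCr n (fun _ : E => c) U := by
  induction n generalizing E c with
  | zero => exact continuousOn_const
  | succ n ih => exact ⟨continuousOn_const, fun _ => 0, fun x _ v => .const c x v, ih _ _⟩

theorem RecCr.clm {E : Type u} [AddCommGroup E] [Module ℝ E] [TopologicalSpace E]
    (n : ℕ) (L : E →L[ℝ] F) (U : Set E) : RecCr n L U := by
  induction n generalizing E with
  | zero => exact L.continuous.continuousOn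
  | succ n ih =>
    exact ⟨L.continuous.continuousOn, L.comp (ContinuousLinearMap.snd ℝ E E),
      fun x _ v => .clm L x v, ih _ _⟩

theorem RecCr.prodMk {E : Type u} [AddCommGroup E] [Module ℝ E] [TopologicalSpace E]
    {n : ℕ} {f : E → F} {g : E → H} {U : Set E} (hf : RecCr n f U) (hg : RecCr n g U) :
    RecCr n (fun x => (f x, g x)) U := by
  induction n generalizing E with
  | zero => exact ContinuousOn.prodMk hf hg
  | succ n ih =>
    obtain ⟨hc, df, hd, hdf⟩ := hf
    obtain ⟨hc', dg, hd', hdg⟩ := hg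
    exact ⟨hc.prodMk hc', _, fun x hx v => (hd x hx v).prodMk (hd' x hx v), ih hdf hdg⟩

theorem RecCr.comp_clm {E : Type u} [AddCommGroup E] [Module ℝ E] [TopologicalSpace E]
    {H : Type u} [AddCommGroup H] [Module ℝ H] [TopologicalSpace H]
    {n : ℕ} {f : H → F} {U : Set H} (hf : RecCr n f U) (L : E →L[ℝ] H) {V : Set E}
    (hV : MapsTo L V U) : RecCr n (fun x => f (L x)) V := by
  induction n generalizing E H with
  | zero => exact ContinuousOn.comp hf L.continuous.continuousOn hV
  | succ n ih =>
    obtain ⟨hc, df, hd, hdf⟩ := hf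
    refine ⟨hc.comp L.continuous.continuousOn hV, fun p => df (L p.1, L p.2), fun x hx v => ?_,
      ih hdf (L.prodMap L) fun p hp => ⟨hV hp.1, trivial⟩⟩
    simpa [HasDirDeriv] using hd (L x) (hV hx) (L v)

/-- Chain rule. -/
theorem RecCr.comp {E : Type u} [AddCommGroup E] [Module ℝ E] [TopologicalSpace E]
    [IsTopologicalAddGroup E] [ContinuousSMul ℝ E]
    {F : Type*} [AddCommGroup F] [Module ℝ F] [TopologicalSpace F]
    [IsTopologicalAddGroup F] [ContinuousSMul ℝ F]
    [IsTopologicalAddGroup H] [ContinuousSMul ℝ H] [LocallyConvexSpace ℝ H]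
    {n : ℕ} {f : E → F} {g : F → H} {U : Set E} {V : Set F} (hg : RecCr n g V) (hf : RecCr n f U)
    (hV : IsOpen V) (hUV : MapsTo f U V) : RecCr n (g ∘ f) U := by
  induction n generalizing E F with
  | zero => exact ContinuousOn.comp hg hf hUV
  | succ n ih =>
    have hf0 := hf.of_succ
    obtain ⟨hc, df, hd, hdf⟩ := hf
    obtain ⟨hc', dg, hd', hdg⟩ := hg
    refine ⟨hc'.comp hc hUV, fun p => dg (f p.1, df p), fun x hx v => ?_, ?_⟩
    · exact (hd x hx v).comp_of_continuousAt hV hd' (hUV hx)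
        (hdg.continuousOn.continuousAt ((hV.prod isOpen_univ).mem_nhds ⟨hUV hx, trivial⟩))
    -- The differential of `g ∘ f` is `dg ∘ (f ∘ pr₁, df)`, again a composition of `C^n`-maps, but
    -- between product spaces; the induction therefore runs over all spaces.
    · refine ih hdg (RecCr.prodMk ?_ hdf) (hV.prod isOpen_univ) fun p hp => ⟨hUV hp.1, trivial⟩
      exact hf0.comp_clm (.fst ℝ E E) fun p hp => hp.1

theorem RecCr.add {E : Type u} [AddCommGroup E] [Module ℝ E] [TopologicalSpace E]
    [IsTopologicalAddGroup F] {n : ℕ} {f g : E → F} {U : Set E} (hf : RecCr n f U)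
    (hg : RecCr n g U) : RecCr n (fun x => f x + g x) U := by
  induction n generalizing E with
  | zero => exact ContinuousOn.add hf hg
  | succ n ih =>
    obtain ⟨hc, df, hd, hdf⟩ := hf
    obtain ⟨hc', dg, hd', hdg⟩ := hg
    exact ⟨hc.add hc', _, fun x hx v => (hd x hx v).add (hd' x hx v), ih hdf hdg⟩

theorem RecCr.sum [IsTopologicalAddGroup F] [ContinuousSMul ℝ F]
    {E : Type u} [AddCommGroup E] [Module ℝ E] [TopologicalSpace E]
    {n : ℕ} {J : Type*} (s : Finset J) {f : J → E → F} {U : Set E}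
    (hf : ∀ i ∈ s, RecCr n (f i) U) : RecCr n (fun x => ∑ i ∈ s, f i x) U := by
  classical
  induction s using Finset.induction_on with
  | empty => simpa using RecCr.const n 0 U
  | insert a s ha ih =>
    simp only [Finset.sum_insert ha]
    exact (hf a (Finset.mem_insert_self _ _)).add
      (ih fun i hi => hf i (Finset.mem_insert_of_mem hi))

theorem RecCr.smul [IsTopologicalAddGroup F] [ContinuousSMul ℝ F]
    {E : Type u} [AddCommGroup E] [Module ℝ E] [TopologicalSpace E]
    {n : ℕ} {c : E → ℝ} {f : E → F} {U : Set E} (hc : RecCr n c U) (hf : RecCr n f U) :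
    RecCr n (fun x => c x • f x) U := by
  induction n generalizing E with
  | zero => exact ContinuousOn.smul hc hf
  | succ n ih =>
    have hc0 := hc.of_succ
    have hf0 := hf.of_succ
    obtain ⟨hcc, dc, hdc, hdc'⟩ := hc
    obtain ⟨hfc, df, hdf, hdf'⟩ := hf
    refine ⟨hcc.smul hfc, fun p => c p.1 • df p + dc p • f p.1, fun x hx v => ?_, ?_⟩
    · exact (hdc x hx v).smul (hdf x hx v)
    · exact (ih (hc0.comp_clm (.fst ℝ E E) fun p hp => hp.1) hdf').add
        (ih hdc' (hf0.comp_clm (.fst ℝ E E) fun p hp => hp.1))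

theorem RecCr.of_contDiff {E : Type u} [NormedAddCommGroup E] [NormedSpace ℝ E]
    {F : Type*} [NormedAddCommGroup F] [NormedSpace ℝ F] {n : ℕ} {f : E → F}
    (hf : ContDiff ℝ n f) (U : Set E) : RecCr n f U := by
  induction n generalizing E with
  | zero => exact hf.continuous.continuousOn
  | succ n ih =>
    have hd : Differentiable ℝ f := hf.differentiable (by simp)
    refine ⟨hf.continuous.continuousOn, fun p => fderiv ℝ f p.1 p.2, fun x _ v => ?_, ih ?_ _⟩
    · have := (hd x).hasFDerivAt.hasLineDerivAt v
      exact hasDerivAt_iff_tendsto_slope_zero.1 this |>.congr fun t => by simp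
    · exact hf.contDiff_fderiv_apply (by simp)

/-- Differentials on the pieces glue because directional derivatives are unique in a Hausdorff
space; `dirDeriv` is the common choice. -/
theorem RecCr.of_local {E : Type u} [AddCommGroup E] [Module ℝ E] [TopologicalSpace E]
    [IsTopologicalAddGroup E] [ContinuousSMul ℝ E] [T2Space F]
    {n : ℕ} {f : E → F} {U : Set E}
    (h : ∀ x ∈ U, ∃ V, IsOpen V ∧ x ∈ V ∧ RecCr n f V) : RecCr n f U := by
  induction n generalizing E with
  | zero =>
    intro x hx
    obtain ⟨V, hV, hxV, hf⟩ := h x hx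
    exact (ContinuousOn.continuousAt hf (hV.mem_nhds hxV)).continuousWithinAt
  | succ n ih =>
    refine ⟨?_, fun p => dirDeriv f p.1 p.2, ?_, ih ?_⟩
    · intro x hx
      obtain ⟨V, hV, hxV, hf⟩ := h x hx
      exact (hf.continuousOn.continuousAt (hV.mem_nhds hxV)).continuousWithinAt
    · intro x hx v
      obtain ⟨V, hV, hxV, -, df, hd, -⟩ := h x hx
      have := hd x hxV v
      rwa [← this.dirDeriv_eq] at this
    · intro p hp
      obtain ⟨V, hV, hxV, -, df, hd, hdf⟩ := h p.1 hp.1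
      refine ⟨V ×ˢ univ, hV.prod isOpen_univ, ⟨hxV, trivial⟩, hdf.congr (hV.prod isOpen_univ) ?_⟩
      exact fun q hq => ((hd q.1 hq.1 q.2).dirDeriv_eq).symm

/-! ### Comparison of the recursive and the iterated description -/

/-- Along `y + t w` the map is a polynomial in `t`, so continuity of `M` is not needed: after
division by `t`, the terms replacing at least two arguments keep a positive power of `t`. -/
theorem HasDirDeriv.of_multilinearMap [IsTopologicalAddGroup F] [ContinuousSMul ℝ F] {k : ℕ}
    (M : MultilinearMap ℝ (fun _ : Fin k => E) F) (y w : Fin k → E) :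
    HasDirDeriv M y w (∑ i, M (Function.update y i (w i))) := by
  have hs : ∀ s : Finset (Fin k), ∀ t : ℝ,
      M (s.piecewise (t • w) y) = t ^ s.card • M (s.piecewise w y) := by
    intro s t
    have := M.map_piecewise_smul (fun _ => t) (s.piecewise w y) s
    simp only [Finset.prod_const] at this
    rw [← this]
    congr 1
    ext i
    by_cases hi : i ∈ s <;> simp [hi]
  have h0 : Tendsto (fun t : ℝ => t) (𝓝[≠] 0) (𝓝 0) := nhdsWithin_le_nhds
  have key : Tendsto (fun t : ℝ => M.linearDeriv y w +
      ∑ s with 2 ≤ Finset.card s, t ^ (s.card - 1) • M (s.piecewise w y)) (𝓝[≠] 0)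
      (𝓝 (M.linearDeriv y w + ∑ s with 2 ≤ Finset.card s, (0 : ℝ) • M (s.piecewise w y))) := by
    refine tendsto_const_nhds.add (tendsto_finsetSum _ fun s hs => ?_)
    have h2 : s.card - 1 ≠ 0 := by have := (Finset.mem_filter.1 hs).2; omega
    have := h0.pow (s.card - 1)
    rw [zero_pow h2] at this
    exact this.smul_const _
  simp only [zero_smul, Finset.sum_const_zero, add_zero, MultilinearMap.linearDeriv_apply] at key
  refine key.congr' ?_
  filter_upwards [self_mem_nhdsWithin] with t ht
  have ht : t ≠ 0 := ht
  rw [M.map_add_eq_map_add_linearDeriv_add, add_assoc, add_sub_cancel_left, map_smul, smul_add,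
    inv_smul_smul₀ ht, Finset.smul_sum, MultilinearMap.linearDeriv_apply]
  congr 1
  refine Finset.sum_congr rfl fun s hs' => ?_
  have h2 := (Finset.mem_filter.1 hs').2
  rw [hs, smul_smul]
  congr 1
  obtain ⟨m, hm⟩ : ∃ m, s.card = m + 1 := ⟨s.card - 1, by omega⟩
  rw [hm, pow_succ']
  simp [ht]

/-- The differentials of a `C^r`-map as in `IsCrOn`. -/
structure IsDifferentials (r : ℕ∞) (d : (k : ℕ) → E → (Fin k → E) → F) (U : Set E) : Prop where
  hasDirDeriv : ∀ k : ℕ, ((k + 1 : ℕ) : ℕ∞) ≤ r → ∀ x ∈ U, ∀ (v : E) (y : Fin k → E),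
      HasDirDeriv (fun z => d k z y) x v (d (k + 1) x (Fin.cons v y : Fin (k + 1) → E))
  continuousOn : ∀ k : ℕ, (k : ℕ∞) ≤ r →
      ContinuousOn (fun p : E × (Fin k → E) => d k p.1 p.2) (U ×ˢ univ)

/-! ### Multilinearity and joint differentiability of the iterated derivatives. -/

section Differentials

variable [IsTopologicalAddGroup E] [ContinuousSMul ℝ E] [IsTopologicalAddGroup F]
  [ContinuousSMul ℝ F] [LocallyConvexSpace ℝ F] [T2Space F] {r : ℕ∞}
  {d : (k : ℕ) → E → (Fin k → E) → F} {U : Set E}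

theorem IsDifferentials.exists_linearMap (h : IsDifferentials r d U) (hU : IsOpen U) {k : ℕ}
    (hk : ((k + 1 : ℕ) : ℕ∞) ≤ r) {x : E} (hx : x ∈ U) (y : Fin k → E) :
    ∃ L : E →ₗ[ℝ] F, ∀ v, L v = d (k + 1) x (Fin.cons v y : Fin (k + 1) → E) := by
  refine ⟨⟨⟨fun v => d (k + 1) x (Fin.cons v y : Fin (k + 1) → E), fun v w => ?_⟩, fun c v => ?_⟩,
    fun v => rfl⟩
  · refine (h.hasDirDeriv k hk x hx (v + w) y).unique ?_
    refine HasDirDeriv.add_dir (df := fun p => d (k + 1) p.1 (Fin.cons p.2 y : Fin (k + 1) → E)) hU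
      (fun z hz u => h.hasDirDeriv k hk z hz u y) hx ?_
    refine ContinuousAt.comp (f := fun p : E × E => (p.1, (Fin.cons p.2 y : Fin (k + 1) → E)))
      (g := fun p : E × (Fin (k + 1) → E) => d (k + 1) p.1 p.2)
      ((h.continuousOn _ hk).continuousAt ((hU.prod isOpen_univ).mem_nhds ⟨hx, trivial⟩)) ?_
    have : Continuous (fun p : E × E => (p.1, (Fin.cons p.2 y : Fin (k + 1) → E))) := by
      refine continuous_fst.prodMk (continuous_pi fun i => ?_)
      refine Fin.cases ?_ (fun i => ?_) i
      · simpa using continuous_snd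
      · simpa using continuous_const
    exact this.continuousAt
  · exact (h.hasDirDeriv k hk x hx (c • v) y).unique ((h.hasDirDeriv k hk x hx v y).smul_dir c)

/-- Linearity in the newest direction is that of the differential of a `C^1`-map. Linearity in an
older direction is an identity valid at all points of the open set `U`, and is inherited by the
derivative. -/
theorem IsDifferentials.exists_multilinearMap (h : IsDifferentials r d U) (hU : IsOpen U) {k : ℕ}
    (hk : (k : ℕ∞) ≤ r) {x : E} (hx : x ∈ U) :
    ∃ M : MultilinearMap ℝ (fun _ : Fin k => E) F, ∀ y, M y = d k x y := by
  induction k generalizing x with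
  | zero =>
    refine ⟨MultilinearMap.constOfIsEmpty ℝ _ (d 0 x Fin.elim0), fun y => ?_⟩
    simp [Subsingleton.elim y Fin.elim0]
  | succ k ih =>
    have hk' : (k : ℕ∞) ≤ r := le_trans (by exact_mod_cast Nat.le_succ k) hk
    refine ⟨⟨d (k + 1) x, ?_, ?_⟩, fun y => rfl⟩
    · intro inst m i
      rw [Subsingleton.elim inst (instDecidableEqFin _)]
      induction m using Fin.consCases with | cons v y => ?_
      induction i using Fin.cases with
      | zero =>
        intro a a'
        obtain ⟨L, hL⟩ := h.exists_linearMap hU hk hx y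
        simp only [Fin.update_cons_zero]
        rw [← hL, ← hL, ← hL, map_add]
      | succ i =>
        intro a a'
        simp only [← Fin.cons_update]
        refine (h.hasDirDeriv k hk x hx v _).unique (HasDirDeriv.congr_of_eqOn
          ((h.hasDirDeriv k hk x hx v _).add (h.hasDirDeriv k hk x hx v _)) hU hx fun z hz => ?_)
        obtain ⟨M, hM⟩ := ih hk' hz
        simp only [← hM, M.map_update_add]
    · intro inst m i
      rw [Subsingleton.elim inst (instDecidableEqFin _)]
      induction m using Fin.consCases with | cons v y => ?_
      induction i using Fin.cases with
      | zero =>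
        intro c a
        obtain ⟨L, hL⟩ := h.exists_linearMap hU hk hx y
        simp only [Fin.update_cons_zero]
        rw [← hL, ← hL, map_smul]
      | succ i =>
        intro c a
        simp only [← Fin.cons_update]
        refine (h.hasDirDeriv k hk x hx v _).unique (HasDirDeriv.congr_of_eqOn
          ((h.hasDirDeriv k hk x hx v _).const_smul c) hU hx fun z hz => ?_)
        obtain ⟨M, hM⟩ := ih hk' hz
        simp only [← hM, M.map_update_smul]

/-- The joint differential of `(x, y) ↦ d^k f (x, y)`. -/
theorem IsDifferentials.hasDirDeriv_prod (h : IsDifferentials r d U) (hU : IsOpen U) {k : ℕ}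
    (hk : ((k + 1 : ℕ) : ℕ∞) ≤ r) {x : E} (hx : x ∈ U) (v : E) (y w : Fin k → E) :
    HasDirDeriv (fun p : E × (Fin k → E) => d k p.1 p.2) (x, y) (v, w)
      (d (k + 1) x (Fin.cons v y : Fin (k + 1) → E) +
        ∑ i, d k x (Function.update y i (w i))) := by
  have hk' : (k : ℕ∞) ≤ r := le_trans (by exact_mod_cast Nat.le_succ k) hk
  obtain ⟨M, hM⟩ := h.exists_multilinearMap hU hk' hx
  have h2 := HasDirDeriv.of_multilinearMap M y w
  simp only [hM] at h2
  have hseg : Tendsto (fun p : ℝ × ℝ => x + (p.2 * p.1) • v) (𝓝[≠] 0 ×ˢ 𝓟 (Icc 0 1)) (𝓝 x) :=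
    tendsto_segment (x := fun _ => x) (v := fun _ => v) (t := fun t : ℝ => t)
      tendsto_const_nhds tendsto_const_nhds nhdsWithin_le_nhds
  -- Split the increment: move `x` with the directions frozen at `y + t w` (`h1`), then move the
  -- directions at fixed `x`, where `d k x` is multilinear (`h2`).
  have h1 := tendsto_quotient (l := 𝓝[≠] (0 : ℝ)) (f := fun t z => d k z (y + t • w))
    (x := fun _ => x) (v := fun _ => v) (t := fun t => t)
    (f' := fun t s => d (k + 1) (x + (s * t) • v) (Fin.cons v (y + t • w) : Fin (k + 1) → E))
    (L := d (k + 1) x (Fin.cons v y : Fin (k + 1) → E)) self_mem_nhdsWithin ?_ ?_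
  · refine (Tendsto.add h1 h2).congr fun t => ?_
    simp only [hM]
    rw [← smul_add, sub_add_sub_cancel]
    rfl
  · filter_upwards [eventually_prod_principal_iff.1 (hseg.eventually (hU.mem_nhds hx))]
      with t ht s hs using h.hasDirDeriv k hk _ (ht s hs) _ _
  · have hc := ((h.continuousOn _ hk).continuousAt (x := (x, Fin.cons v y))
      ((hU.prod isOpen_univ).mem_nhds ⟨hx, trivial⟩)).tendsto
    refine hc.comp (hseg.prodMk_nhds (tendsto_pi_nhds.2 fun i => ?_))
    refine Fin.cases ?_ (fun i => ?_) i
    · exact tendsto_const_nhds (x := v)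
    · have := ((tendsto_add_smul_nhds y w).comp (tendsto_fst (g := 𝓟 (Icc (0 : ℝ) 1))))
      exact tendsto_pi_nhds.1 this i

end Differentials

/-- The linear map `((x, y), (v, w)) ↦ (x, (v, y))`. -/
def consDir (E : Type*) [AddCommGroup E] [Module ℝ E] [TopologicalSpace E] (k : ℕ) :
    (E × (Fin k → E)) × (E × (Fin k → E)) →L[ℝ] E × (Fin (k + 1) → E) where
  toFun p := (p.1.1, Fin.cons p.2.1 p.1.2)
  map_add' p q := by
    ext i
    · rfl
    · refine Fin.cases ?_ (fun i => ?_) i <;> simp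
  map_smul' c p := by
    ext i
    · rfl
    · refine Fin.cases ?_ (fun i => ?_) i <;> simp
  cont := by
    refine (by fun_prop : Continuous fun p : (E × (Fin k → E)) × (E × (Fin k → E)) =>
      p.1.1).prodMk (continuous_pi fun i => ?_)
    refine Fin.cases ?_ (fun i => ?_) i <;> simp only [Fin.cons_zero, Fin.cons_succ] <;> fun_prop

/-- The linear map `((x, y), (v, w)) ↦ (x, y')`, where `y'` has the components of `y` except for
the `i`-th, which is `w i`. -/
def updateDir (E : Type*) [AddCommGroup E] [Module ℝ E] [TopologicalSpace E] (k : ℕ) (i : Fin k) :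
    (E × (Fin k → E)) × (E × (Fin k → E)) →L[ℝ] E × (Fin k → E) where
  toFun p := (p.1.1, Function.update p.1.2 i (p.2.2 i))
  map_add' p q := by
    ext j
    · rfl
    · by_cases h : j = i <;> simp [h]
  map_smul' c p := by
    ext j
    · rfl
    · by_cases h : j = i <;> simp [h]
  cont := by
    refine (by fun_prop : Continuous fun p : (E × (Fin k → E)) × (E × (Fin k → E)) =>
      p.1.1).prodMk (continuous_pi fun j => ?_)
    by_cases h : j = i <;> simp only [Function.update_apply, h, if_true, if_false] <;> fun_prop

/-- The linear map `(x, (v, y)) ↦ ((x, y), (v, 0))`. -/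
def tailDir (E : Type*) [AddCommGroup E] [Module ℝ E] [TopologicalSpace E] (k : ℕ) :
    E × (Fin (k + 1) → E) →L[ℝ] (E × (Fin k → E)) × (E × (Fin k → E)) where
  toFun p := ((p.1, Fin.tail p.2), (p.2 0, 0))
  map_add' p q := by ext <;> simp [Fin.tail]
  map_smul' c p := by ext <;> simp [Fin.tail]
  cont := by
    change Continuous fun p : E × (Fin (k + 1) → E) =>
      ((p.1, fun i : Fin k => p.2 i.succ), (p.2 0, (0 : Fin k → E)))
    fun_prop

/-- The joint differential of `d k` is a sum of `d (k + 1)` and copies of `d k`, each precomposed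
with a continuous linear map. Induction on `m` for all `k` at once thus closes, `k + m ≤ r` being
the available order. -/
theorem IsDifferentials.recCr {E : Type u} [AddCommGroup E] [Module ℝ E] [TopologicalSpace E]
    [IsTopologicalAddGroup E] [ContinuousSMul ℝ E] [IsTopologicalAddGroup F]
    [ContinuousSMul ℝ F] [LocallyConvexSpace ℝ F] [T2Space F] {r : ℕ∞}
    {d : (k : ℕ) → E → (Fin k → E) → F} {U : Set E} (h : IsDifferentials r d U) (hU : IsOpen U)
    (m : ℕ) {k : ℕ} (hk : ((k + m : ℕ) : ℕ∞) ≤ r) :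
    RecCr m (fun p : E × (Fin k → E) => d k p.1 p.2) (U ×ˢ univ) := by
  induction m generalizing k with
  | zero => exact h.continuousOn k hk
  | succ m ih =>
    have hk1 : ((k + 1 : ℕ) : ℕ∞) ≤ r := le_trans (by norm_cast; omega) hk
    have hk0 : (k : ℕ∞) ≤ r := le_trans (by norm_cast; omega) hk
    have hk' : ((k + m : ℕ) : ℕ∞) ≤ r := le_trans (by norm_cast; omega) hk
    have hk1' : ((k + 1 + m : ℕ) : ℕ∞) ≤ r := le_trans (by norm_cast; omega) hk
    refine ⟨h.continuousOn k hk0, fun p => d (k + 1) p.1.1 (Fin.cons p.2.1 p.1.2 : Fin (k + 1) → E) +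
      ∑ i, d k p.1.1 (Function.update p.1.2 i (p.2.2 i)),
      fun x hx v => h.hasDirDeriv_prod hU hk1 hx.1 v.1 x.2 v.2, ?_⟩
    refine RecCr.add ?_ (RecCr.sum _ fun i _ => ?_)
    · exact (ih hk1').comp_clm (consDir E k) fun p hp => ⟨hp.1.1, trivial⟩
    · exact (ih hk').comp_clm (updateDir E k i) fun p hp => ⟨hp.1.1, trivial⟩

theorem IsCrOn.recCr {E : Type u} [AddCommGroup E] [Module ℝ E] [TopologicalSpace E]
    [IsTopologicalAddGroup E] [ContinuousSMul ℝ E] [IsTopologicalAddGroup F]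
    [ContinuousSMul ℝ F] [LocallyConvexSpace ℝ F] [T2Space F] {r : ℕ∞} {f : E → F} {U : Set E}
    (h : IsCrOn r f U) (hU : IsOpen U) {n : ℕ} (hn : (n : ℕ∞) ≤ r) : RecCr n f U := by
  obtain ⟨d, h0, h1, h2⟩ := h
  have hd : IsDifferentials r d U := ⟨h1, h2⟩
  have := (hd.recCr hU n (k := 0) (by simpa using hn)).comp_clm
    ((ContinuousLinearMap.id ℝ E).prod 0) (V := U) fun p hp => ⟨hp, trivial⟩
  exact this.congr hU fun x hx => h0 x hx _

/-- The iterated directional derivatives of `f`. -/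
def iterDirDeriv (f : E → F) : (k : ℕ) → E → (Fin k → E) → F
  | 0, x, _ => f x
  | k + 1, x, y => dirDeriv (fun z => iterDirDeriv f k z (Fin.tail y)) x (y 0)

/-- The derivative of order `k + 1` is the joint differential of the one of order `k` in the
direction `(v, 0)`; each step uses up one order. -/
theorem RecCr.iterDirDeriv {E : Type u} [AddCommGroup E] [Module ℝ E] [TopologicalSpace E]
    [IsTopologicalAddGroup E] [ContinuousSMul ℝ E] [T2Space F]
    {r : ℕ∞} {f : E → F} {U : Set E} (hU : IsOpen U) (h : ∀ n : ℕ, (n : ℕ∞) ≤ r → RecCr n f U)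
    (k m : ℕ) (hk : ((k + m : ℕ) : ℕ∞) ≤ r) :
    RecCr m (fun p : E × (Fin k → E) => iterDirDeriv f k p.1 p.2) (U ×ˢ univ) := by
  induction k generalizing m with
  | zero => exact (h m (by simpa using hk)).comp_clm (.fst ℝ E (Fin 0 → E)) fun p hp => hp.1
  | succ k ih =>
    obtain ⟨-, dg, hd, hdg⟩ := ih (m + 1) (le_trans (by norm_cast; omega) hk)
    refine (hdg.comp_clm (tailDir E k) (V := U ×ˢ univ)
      fun p hp => ⟨⟨hp.1, trivial⟩, trivial⟩).congr (hU.prod isOpen_univ) fun p hp => ?_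
    have := hd (p.1, Fin.tail p.2) ⟨hp.1, trivial⟩ (p.2 0, 0)
    refine (HasDirDeriv.dirDeriv_eq (this.congr fun t => ?_)).symm
    simp

theorem RecCr.isCrOn {E : Type u} [AddCommGroup E] [Module ℝ E] [TopologicalSpace E]
    [IsTopologicalAddGroup E] [ContinuousSMul ℝ E] [T2Space F]
    {r : ℕ∞} {f : E → F} {U : Set E} (hU : IsOpen U) (h : ∀ n : ℕ, (n : ℕ∞) ≤ r → RecCr n f U) :
    IsCrOn r f U := by
  refine ⟨LCLie.iterDirDeriv f, fun x _ y => rfl, fun k hk x hx v y => ?_, fun k hk =>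
    (RecCr.iterDirDeriv hU h k 0 (by simpa using hk)).continuousOn⟩
  obtain ⟨-, dg, hd, -⟩ := RecCr.iterDirDeriv hU h k 1 hk
  have h1 : HasDirDeriv (fun z => LCLie.iterDirDeriv f k z y) x v (dg ((x, y), (v, 0))) :=
    (hd (x, y) ⟨hx, trivial⟩ (v, 0)).congr fun t => by simp
  have h2 : LCLie.iterDirDeriv f (k + 1) x (Fin.cons v y : Fin (k + 1) → E) =
      dg ((x, y), (v, 0)) := by
    simpa [LCLie.iterDirDeriv] using h1.dirDeriv_eq
  rwa [h2]

theorem isCrOn_iff_recCr {E : Type u} [AddCommGroup E] [Module ℝ E] [TopologicalSpace E]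
    [IsTopologicalAddGroup E] [ContinuousSMul ℝ E] [IsTopologicalAddGroup F]
    [ContinuousSMul ℝ F] [LocallyConvexSpace ℝ F] [T2Space F] {r : ℕ∞} {f : E → F} {U : Set E}
    (hU : IsOpen U) : IsCrOn r f U ↔ ∀ n : ℕ, (n : ℕ∞) ≤ r → RecCr n f U :=
  ⟨fun h _ hn => h.recCr hU hn, RecCr.isCrOn hU⟩

end Recursive

/-! ### `C^r`-maps near a point -/

section Near

variable {E : Type*} [AddCommGroup E] [Module ℝ E] [TopologicalSpace E]
  [IsTopologicalAddGroup E] [ContinuousSMul ℝ E]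
variable {F : Type*} [AddCommGroup F] [Module ℝ F] [TopologicalSpace F]
  [IsTopologicalAddGroup F] [ContinuousSMul ℝ F] [LocallyConvexSpace ℝ F] [T2Space F]
variable {H : Type*} [AddCommGroup H] [Module ℝ H] [TopologicalSpace H]
  [IsTopologicalAddGroup H] [ContinuousSMul ℝ H] [LocallyConvexSpace ℝ H] [T2Space H]
variable {r : ℕ∞}

theorem IsCrOn.mono_order {r' : ℕ∞} {f : E → F} {U : Set E} (h : IsCrOn r f U) (hr : r' ≤ r) :
    IsCrOn r' f U := by
  obtain ⟨d, h0, h1, h2⟩ := h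
  exact ⟨d, h0, fun k hk => h1 k (hk.trans hr), fun k hk => h2 k (hk.trans hr)⟩

theorem IsCrOn.mono {f : E → F} {U V : Set E} (h : IsCrOn r f U) (hV : V ⊆ U) :
    IsCrOn r f V := by
  obtain ⟨d, h0, h1, h2⟩ := h
  exact ⟨d, fun x hx => h0 x (hV hx), fun k hk x hx => h1 k hk x (hV hx),
    fun k hk => (h2 k hk).mono (prod_mono_left hV)⟩

theorem IsCrOn.congr {f g : E → F} {U : Set E} (h : IsCrOn r f U)
    (hfg : EqOn f g U) : IsCrOn r g U := by
  obtain ⟨d, h0, h1, h2⟩ := h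
  exact ⟨d, fun x hx y => (h0 x hx y).trans (hfg hx), h1, h2⟩

theorem IsCrOn.continuousOn {f : E → F} {U : Set E} (h : IsCrOn r f U) (hU : IsOpen U) :
    ContinuousOn f U :=
  (h.recCr hU (n := 0) (by simp)).continuousOn

/-- `f` is `C^r` on some neighbourhood of `x`. -/
def CrNear (r : ℕ∞) (f : E → F) (x : E) : Prop :=
  ∃ U, IsOpen U ∧ x ∈ U ∧ IsCrOn r f U

theorem IsCrOn.crNear {f : E → F} {U : Set E} (h : IsCrOn r f U) (hU : IsOpen U) {x : E}
    (hx : x ∈ U) : CrNear r f x :=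
  ⟨U, hU, hx, h⟩

theorem isCrOn_of_crNear {f : E → F} {U : Set E} (hU : IsOpen U) (h : ∀ x ∈ U, CrNear r f x) :
    IsCrOn r f U := by
  refine (isCrOn_iff_recCr hU).2 fun n hn => RecCr.of_local fun x hx => ?_
  obtain ⟨V, hV, hxV, hf⟩ := h x hx
  exact ⟨V, hV, hxV, hf.recCr hV hn⟩

theorem CrNear.of_recCr {f : E → F} {U : Set E} (hU : IsOpen U)
    (h : ∀ n : ℕ, (n : ℕ∞) ≤ r → RecCr n f U) {x : E} (hx : x ∈ U) : CrNear r f x :=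
  ⟨U, hU, hx, RecCr.isCrOn hU h⟩

theorem CrNear.mono_order {r' : ℕ∞} {f : E → F} {x : E} (h : CrNear r f x) (hr : r' ≤ r) :
    CrNear r' f x := by
  obtain ⟨U, hU, hx, h⟩ := h
  exact ⟨U, hU, hx, h.mono_order hr⟩

theorem CrNear.continuousAt {f : E → F} {x : E} (h : CrNear r f x) : ContinuousAt f x := by
  obtain ⟨U, hU, hx, h⟩ := h
  exact (h.continuousOn hU).continuousAt (hU.mem_nhds hx)

theorem CrNear.congr {f g : E → F} {x : E} (h : CrNear r f x) (hfg : f =ᶠ[𝓝 x] g) :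
    CrNear r g x := by
  obtain ⟨U, hU, hx, h⟩ := h
  obtain ⟨V, hVfg, hV, hxV⟩ := eventually_nhds_iff.1 hfg
  exact ⟨U ∩ V, hU.inter hV, ⟨hx, hxV⟩,
    (h.mono inter_subset_left).congr fun z hz => hVfg z hz.2⟩

theorem CrNear.comp {g : F → H} {f : E → F} {x : E} (hg : CrNear r g (f x)) (hf : CrNear r f x) :
    CrNear r (g ∘ f) x := by
  obtain ⟨U, hU, hx, hf⟩ := hf
  obtain ⟨V, hV, hxV, hg⟩ := hg
  have hW := (hf.continuousOn hU).isOpen_inter_preimage hU hV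
  exact .of_recCr hW (fun n hn => (hg.recCr hV hn).comp ((hf.recCr hU hn).mono inter_subset_left)
    hV fun z hz => hz.2) ⟨hx, hxV⟩

theorem CrNear.clm (L : E →L[ℝ] F) (x : E) : CrNear r L x :=
  .of_recCr isOpen_univ (fun n _ => .clm n L _) trivial

theorem CrNear.const (c : F) (x : E) : CrNear r (fun _ => c) x :=
  .of_recCr isOpen_univ (fun n _ => .const n c _) trivial

theorem CrNear.prodMk {f : E → F} {g : E → H} {x : E} (hf : CrNear r f x) (hg : CrNear r g x) :
    CrNear r (fun z => (f z, g z)) x := by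
  obtain ⟨U, hU, hx, hf⟩ := hf
  obtain ⟨V, hV, hxV, hg⟩ := hg
  exact .of_recCr (hU.inter hV) (fun n hn => ((hf.recCr hU hn).mono inter_subset_left).prodMk
    ((hg.recCr hV hn).mono inter_subset_right)) ⟨hx, hxV⟩

theorem CrNear.add {f g : E → F} {x : E} (hf : CrNear r f x) (hg : CrNear r g x) :
    CrNear r (fun z => f z + g z) x := by
  obtain ⟨U, hU, hx, hf⟩ := hf
  obtain ⟨V, hV, hxV, hg⟩ := hg
  exact .of_recCr (hU.inter hV) (fun n hn => ((hf.recCr hU hn).mono inter_subset_left).add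
    ((hg.recCr hV hn).mono inter_subset_right)) ⟨hx, hxV⟩

theorem CrNear.smul {c : E → ℝ} {f : E → F} {x : E} (hc : CrNear r c x) (hf : CrNear r f x) :
    CrNear r (fun z => c z • f z) x := by
  obtain ⟨U, hU, hx, hf⟩ := hf
  obtain ⟨V, hV, hxV, hc⟩ := hc
  exact .of_recCr (hU.inter hV) (fun n hn => ((hc.recCr hV hn).mono inter_subset_right).smul
    ((hf.recCr hU hn).mono inter_subset_left)) ⟨hx, hxV⟩

theorem CrNear.of_contDiff {c : ℝ → ℝ} (hc : ∀ n : ℕ, ContDiff ℝ n c) (x : ℝ) : CrNear r c x :=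
  .of_recCr isOpen_univ (fun n _ => .of_contDiff (hc n) _) trivial

theorem CrNear.id [LocallyConvexSpace ℝ E] [T2Space E] (x : E) : CrNear r (fun z : E => z) x :=
  .clm (.id ℝ E) x

theorem CrNear.exists_clm {f : E → F} {x : E} (hf : CrNear r f x) (hr : 1 ≤ r) :
    ∃ L : E →L[ℝ] F, ∀ v, HasDirDeriv f x v (L v) := by
  obtain ⟨U, hU, hx, hf⟩ := hf
  obtain ⟨-, df, hd, hdf⟩ := hf.recCr hU (n := 1) (by exact_mod_cast hr)
  have hc : ∀ v, ContinuousAt df (x, v) := fun v =>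
    ContinuousOn.continuousAt hdf ((hU.prod isOpen_univ).mem_nhds ⟨hx, trivial⟩)
  refine ⟨⟨⟨⟨fun v => df (x, v), fun v w => ?_⟩, fun c v => ?_⟩, ?_⟩, fun v => hd x hx v⟩
  · exact (hd x hx _).unique (HasDirDeriv.add_dir hU hd hx (hc w))
  · exact (hd x hx _).unique ((hd x hx v).smul_dir c)
  · exact continuous_iff_continuousAt.2 fun v =>
      ContinuousAt.comp (f := fun v => (x, v)) (hc v) (by fun_prop)

theorem HasDirDeriv.comp_crNear {g : F → H} {f : E → F} {x v : E} {w : F} {L : F →L[ℝ] H}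
    (hg : CrNear r g (f x)) (hr : 1 ≤ r) (hL : ∀ w, HasDirDeriv g (f x) w (L w))
    (hf : HasDirDeriv f x v w) : HasDirDeriv (g ∘ f) x v (L w) := by
  obtain ⟨V, hV, hxV, hg⟩ := hg
  obtain ⟨-, dg, hd, hdg⟩ := hg.recCr hV (n := 1) (by exact_mod_cast hr)
  rw [(hL w).unique (hd _ hxV w)]
  exact hf.comp_of_continuousAt hV hd hxV
    (ContinuousOn.continuousAt hdg ((hV.prod isOpen_univ).mem_nhds ⟨hxV, trivial⟩))

end Near

/-! ### `C^r`-maps between manifolds near a point -/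

section Manifold

variable (E : Type*) [AddCommGroup E] [Module ℝ E] [TopologicalSpace E]
  [IsTopologicalAddGroup E] [ContinuousSMul ℝ E] [LocallyConvexSpace ℝ E] [T2Space E]
variable (F : Type*) [AddCommGroup F] [Module ℝ F] [TopologicalSpace F]
  [IsTopologicalAddGroup F] [ContinuousSMul ℝ F] [LocallyConvexSpace ℝ F] [T2Space F]
variable (H : Type*) [AddCommGroup H] [Module ℝ H] [TopologicalSpace H]
  [IsTopologicalAddGroup H] [ContinuousSMul ℝ H] [LocallyConvexSpace ℝ H] [T2Space H]
variable {M : Type*} [TopologicalSpace M] [ChartedSpace E M]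
variable {N : Type*} [TopologicalSpace N] [ChartedSpace F N]
variable {P : Type*} [TopologicalSpace P] [ChartedSpace H P]
variable {r : ℕ∞}

/-- `f` is continuous at `x`, and it is `C^r` near `x` in the preferred charts. -/
def MCrAt (r : ℕ∞) (f : M → N) (x : M) : Prop :=
  ContinuousAt f x ∧ CrNear r (chartAt F (f x) ∘ f ∘ (chartAt E x).symm) (chartAt E x x)

variable {E F H}

theorem eventually_chart_symm {e : OpenPartialHomeomorph M E} {x : M} (hx : x ∈ e.source)
    {p : M → Prop} (hp : ∀ᶠ z in 𝓝 x, p z) :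
    ∀ᶠ v in 𝓝 (e x), v ∈ e.target ∧ p (e.symm v) := by
  refine (eventually_mem_set.2 (e.open_target.mem_nhds (e.map_source hx))).and
    ((e.continuousAt_symm (e.map_source hx)).eventually ?_)
  rwa [e.left_inv hx]

theorem CrNear.change_charts {f : M → N} {x : M} {e₁ e₂ : OpenPartialHomeomorph M E}
    {e₁' e₂' : OpenPartialHomeomorph N F} (h1x : x ∈ e₁.source) (h2x : x ∈ e₂.source)
    (h1y : f x ∈ e₁'.source) (hfc : ContinuousAt f x)
    (h : CrNear r (e₁' ∘ f ∘ e₁.symm) (e₁ x)) (h1 : CrNear r (e₁ ∘ e₂.symm) (e₂ x))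
    (h2 : CrNear r (e₂' ∘ e₁'.symm) (e₁' (f x))) : CrNear r (e₂' ∘ f ∘ e₂.symm) (e₂ x) := by
  have a1 : (e₁ ∘ e₂.symm) (e₂ x) = e₁ x := by simp [h2x]
  have a2 : (e₁' ∘ f ∘ e₁.symm) (e₁ x) = e₁' (f x) := by simp [h1x]
  rw [← a2] at h2
  have h3 := h2.comp h
  rw [← a1] at h3
  refine (h3.comp h1).congr ?_
  have := eventually_chart_symm h2x ((eventually_mem_set.2 (e₁.open_source.mem_nhds h1x)).and
    (hfc.eventually (e₁'.open_source.mem_nhds h1y)))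
  filter_upwards [this] with v ⟨_, hv1, hv2⟩
  have hv1 : e₂.symm v ∈ e₁.source := hv1
  have hv2 : f (e₂.symm v) ∈ e₁'.source := hv2
  simp [hv1, hv2]

theorem MCrAt.continuousAt {f : M → N} {x : M} (h : MCrAt E F r f x) : ContinuousAt f x := h.1

theorem MCrAt.mono_order {r' : ℕ∞} {f : M → N} {x : M} (h : MCrAt E F r f x) (hr : r' ≤ r) :
    MCrAt E F r' f x :=
  ⟨h.1, h.2.mono_order hr⟩

theorem MCrAt.comp {g : N → P} {f : M → N} {x : M} (hg : MCrAt F H r g (f x))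
    (hf : MCrAt E F r f x) : MCrAt E H r (g ∘ f) x := by
  refine ⟨ContinuousAt.comp hg.1 hf.1, ?_⟩
  have a : (chartAt F (f x) ∘ f ∘ (chartAt E x).symm) (chartAt E x x) = chartAt F (f x) (f x) := by
    simp
  have h := hg.2
  rw [← a] at h
  refine (h.comp hf.2).congr ?_
  filter_upwards [eventually_chart_symm (mem_chart_source E x)
    (hf.1.eventually (chart_source_mem_nhds F (f x)))] with v ⟨_, hv⟩
  have hv : f ((chartAt E x).symm v) ∈ (chartAt F (f x)).source := hv
  simp [hv]

theorem MCrAt.congr {f g : M → N} {x : M} (h : MCrAt E F r f x) (hfg : f =ᶠ[𝓝 x] g) :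
    MCrAt E F r g x := by
  refine ⟨h.1.congr hfg, ?_⟩
  have h2 := h.2
  rw [hfg.self_of_nhds] at h2
  refine h2.congr ?_
  filter_upwards [eventually_chart_symm (mem_chart_source E x) hfg] with v ⟨_, hv⟩
  simp [hv]

theorem MCrAt.const (c : N) (x : M) : MCrAt E F r (fun _ : M => c) x :=
  ⟨continuousAt_const, CrNear.const (chartAt F c c) _⟩

theorem mCrAt_iff_crNear {f : E → F} {x : E} : MCrAt E F r f x ↔ CrNear r f x := by
  change ContinuousAt f x ∧ CrNear r f x ↔ CrNear r f x
  exact ⟨fun h => h.2, fun h => ⟨h.continuousAt, h⟩⟩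

theorem IsCrMap.mCrAt {f : M → N} (h : IsCrMap E F r f) (x : M) : MCrAt E F r f x := by
  refine ⟨h.1.continuousAt, (h.2 _ (chart_mem_atlas E x) _ (chart_mem_atlas F (f x))).crNear
    ((chartAt E x).symm.continuousOn.isOpen_inter_preimage (chartAt E x).open_target
      ((chartAt F (f x)).open_source.preimage h.1)) ⟨mem_chart_target E x, ?_⟩⟩
  simp

theorem IsCrManifold.mono_order {r' : ℕ∞} (h : IsCrManifold E r M) (hr : r' ≤ r) :
    IsCrManifold E r' M :=
  ⟨h.1, fun e he e' he' => (h.2 e he e' he').mono_order hr⟩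

theorem IsCrManifold.isCrChart (h : IsCrManifold E r M) {e : OpenPartialHomeomorph M E}
    (he : e ∈ atlas E M) : IsCrChart r e :=
  fun c hc => ⟨h.2 c hc e he, h.2 e he c hc⟩

theorem isCrManifold_self : IsCrManifold E r E := by
  refine ⟨inferInstance, fun e he e' he' => ?_⟩
  rw [chartedSpaceSelf_atlas] at he he'
  subst he he'
  exact isCrOn_of_crNear (OpenPartialHomeomorph.open_source _) fun x _ => CrNear.id x

theorem IsCrChart.crNear {e : OpenPartialHomeomorph M E} (h : IsCrChart r e)
    {c : OpenPartialHomeomorph M E} (hc : c ∈ atlas E M) {x : M} (hx : x ∈ e.source)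
    (hxc : x ∈ c.source) : CrNear r (e ∘ c.symm) (c x) :=
  (h c hc).1.crNear (c.symm.trans e).open_source (by simp [hx, hxc])

theorem IsCrChart.crNear_symm {e : OpenPartialHomeomorph M E} (h : IsCrChart r e)
    {c : OpenPartialHomeomorph M E} (hc : c ∈ atlas E M) {x : M} (hx : x ∈ e.source)
    (hxc : x ∈ c.source) : CrNear r (c ∘ e.symm) (e x) :=
  (h c hc).2.crNear (e.symm.trans c).open_source (by simp [hx, hxc])

theorem MCrAt.crNear_charts {f : M → N} {x : M} (h : MCrAt E F r f x)
    {e : OpenPartialHomeomorph M E} (he : IsCrChart r e) (hx : x ∈ e.source)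
    {e' : OpenPartialHomeomorph N F} (he' : IsCrChart r e') (hy : f x ∈ e'.source) :
    CrNear r (e' ∘ f ∘ e.symm) (e x) :=
  h.2.change_charts (mem_chart_source E x) hx (mem_chart_source F (f x)) h.1
    (he.crNear_symm (chart_mem_atlas E x) hx (mem_chart_source E x))
    (he'.crNear (chart_mem_atlas F (f x)) hy (mem_chart_source F (f x)))

theorem mCrAt_of_crNear_charts {f : M → N} {x : M} (hfc : ContinuousAt f x)
    {e : OpenPartialHomeomorph M E} (he : IsCrChart r e) (hx : x ∈ e.source)
    {e' : OpenPartialHomeomorph N F} (he' : IsCrChart r e') (hy : f x ∈ e'.source)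
    (h : CrNear r (e' ∘ f ∘ e.symm) (e x)) : MCrAt E F r f x :=
  ⟨hfc, h.change_charts hx (mem_chart_source E x) hy hfc
    (he.crNear (chart_mem_atlas E x) hx (mem_chart_source E x))
    (he'.crNear_symm (chart_mem_atlas F (f x)) hy (mem_chart_source F (f x)))⟩

theorem isCrMap_of_mCrAt {f : M → N} (hM : IsCrManifold E r M) (hN : IsCrManifold F r N)
    (h : ∀ x, MCrAt E F r f x) : IsCrMap E F r f := by
  have hc : Continuous f := continuous_iff_continuousAt.2 fun x => (h x).1
  refine ⟨hc, fun e he e' he' => isCrOn_of_crNear (e.symm.continuousOn.isOpen_inter_preimage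
    e.open_target (e'.open_source.preimage hc)) fun v hv => ?_⟩
  have := (h (e.symm v)).crNear_charts (hM.isCrChart he) (e.map_target hv.1) (hN.isCrChart he') hv.2
  rwa [e.right_inv hv.1] at this

theorem IsCrMap.mono_order {r' : ℕ∞} {f : M → N} (h : IsCrMap E F r f) (hr : r' ≤ r) :
    IsCrMap E F r' f :=
  ⟨h.1, fun e he e' he' => (h.2 e he e' he').mono_order hr⟩

theorem IsCrChart.refl : IsCrChart r (OpenPartialHomeomorph.refl E) :=
  (isCrManifold_self (E := E)).isCrChart (by simp)

theorem IsCrChart.mCrAt {e : OpenPartialHomeomorph M E} (he : IsCrChart r e) {x : M}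
    (hx : x ∈ e.source) : MCrAt E E r e x := by
  refine mCrAt_of_crNear_charts (e.continuousAt hx) he hx IsCrChart.refl trivial
    ((CrNear.id (e x)).congr ?_)
  filter_upwards [e.open_target.mem_nhds (e.map_source hx)] with v hv
  simp [hv]

theorem IsCrChart.mCrAt_symm {e : OpenPartialHomeomorph M E} (he : IsCrChart r e) {v : E}
    (hv : v ∈ e.target) : MCrAt E E r e.symm v := by
  refine mCrAt_of_crNear_charts (e.continuousAt_symm hv) IsCrChart.refl trivial he
    (e.map_target hv) ((CrNear.id v).congr ?_)
  filter_upwards [e.open_target.mem_nhds hv] with v hv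
  simp [hv]

/-- Composition of a chart with a diffeomorphism of the modelling space. -/
theorem IsCrChart.transHomeomorph {e : OpenPartialHomeomorph M E} (he : IsCrChart r e)
    (A : E ≃ₜ E) (hA : ∀ v, CrNear r A v) (hA' : ∀ v, CrNear r A.symm v) :
    IsCrChart r (e.transHomeomorph A) := by
  refine fun c hc => ⟨isCrOn_of_crNear (OpenPartialHomeomorph.open_source _) fun v hv => ?_,
    isCrOn_of_crNear (OpenPartialHomeomorph.open_source _) fun v hv => ?_⟩
  · simp only [OpenPartialHomeomorph.trans_source, OpenPartialHomeomorph.symm_source, mem_inter_iff,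
      mem_preimage, OpenPartialHomeomorph.transHomeomorph_source] at hv
    exact (hA _).comp ((he c hc).1.crNear (OpenPartialHomeomorph.open_source _) (x := v)
      (by simpa using hv))
  · simp only [OpenPartialHomeomorph.trans_source, OpenPartialHomeomorph.symm_source, mem_inter_iff,
      mem_preimage, OpenPartialHomeomorph.transHomeomorph_target] at hv
    exact CrNear.comp (f := A.symm) ((he c hc).2.crNear (OpenPartialHomeomorph.open_source _)
      (x := A.symm v) (by simpa using hv)) (hA' v)

end Manifold

/-! ### Lie groups and their tangent maps -/

section LieGroup

variable {E : Type*} [AddCommGroup E] [Module ℝ E] [TopologicalSpace E]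
  [IsTopologicalAddGroup E] [ContinuousSMul ℝ E] [LocallyConvexSpace ℝ E] [T2Space E]
variable {F : Type*} [AddCommGroup F] [Module ℝ F] [TopologicalSpace F]
  [IsTopologicalAddGroup F] [ContinuousSMul ℝ F] [LocallyConvexSpace ℝ F] [T2Space F]
variable {H : Type*} [AddCommGroup H] [Module ℝ H] [TopologicalSpace H]
  [IsTopologicalAddGroup H] [ContinuousSMul ℝ H] [LocallyConvexSpace ℝ H] [T2Space H]
variable {G : Type*} [Group G] [TopologicalSpace G] [ChartedSpace E G]
variable {G' : Type*} [Group G'] [TopologicalSpace G'] [ChartedSpace F G']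
variable {G'' : Type*} [Group G''] [TopologicalSpace G''] [ChartedSpace H G'']

theorem IsLieGroup.isTopologicalGroup (hG : IsLieGroup E G) : IsTopologicalGroup G where
  continuous_mul := hG.smooth_mul.1
  continuous_inv := hG.smooth_inv.1

theorem IsLieGroup.mCrAt_mul_left (hG : IsLieGroup E G) (g x : G) :
    MCrAt E E ⊤ (fun y => g * y) x := by
  let _ : ChartedSpace (E × E) (G × G) := prodChartedSpace E G E G
  have h1 : MCrAt (E × E) E ⊤ (fun p : G × G => p.1 * p.2) (g, x) := hG.smooth_mul.mCrAt (g, x)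
  have h2 : MCrAt E (E × E) ⊤ (fun y : G => (g, y)) x := by
    refine ⟨by fun_prop, ?_⟩
    have : CrNear ⊤ (fun v : E => (chartAt E g g, v)) (chartAt E x x) :=
      (CrNear.const _ _).prodMk (CrNear.id _)
    refine this.congr ?_
    filter_upwards [(chartAt E x).open_target.mem_nhds (mem_chart_target E x)] with v hv
    change (chartAt E g g, v) = (chartAt E g g, chartAt E x ((chartAt E x).symm v))
    rw [(chartAt E x).right_inv hv]
  exact h1.comp h2

/-- The change between two charts has an invertible differential. -/
theorem exists_clequiv_chart_change {M : Type*} [TopologicalSpace M] [ChartedSpace E M]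
    {e : OpenPartialHomeomorph M E} (he : IsCrChart ⊤ e) {x : M} (hx : x ∈ e.source) :
    ∃ A : E ≃L[ℝ] E, ∀ v, HasDirDeriv (chartAt E x ∘ e.symm) (e x) v (A v) := by
  have hc := mem_chart_source E x
  have h1 := he.crNear (chart_mem_atlas E x) hx hc
  have h2 := he.crNear_symm (chart_mem_atlas E x) hx hc
  obtain ⟨L1, hL1⟩ := h1.exists_clm le_top
  obtain ⟨L2, hL2⟩ := h2.exists_clm le_top
  have e1 : (e ∘ (chartAt E x).symm) (chartAt E x x) = e x := by simp
  have e2 : (chartAt E x ∘ e.symm) (e x) = chartAt E x x := by simp [hx]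
  refine ⟨ContinuousLinearEquiv.equivOfInverse L2 L1 (fun v => ?_) (fun v => ?_), hL2⟩
  · have : HasDirDeriv ((e ∘ (chartAt E x).symm) ∘ (chartAt E x ∘ e.symm)) (e x) v (L1 (L2 v)) :=
      HasDirDeriv.comp_crNear (r := ⊤) (by rwa [e2]) le_top (by rwa [e2]) (hL2 v)
    refine this.unique ((HasDirDeriv.clm (.id ℝ E) (e x) v).congr_of_eventuallyEq ?_)
    filter_upwards [eventually_chart_symm hx (chart_source_mem_nhds E x)] with w ⟨hw, hw'⟩
    have hw' : e.symm w ∈ (chartAt E x).source := hw'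
    simp [hw, hw']
  · have : HasDirDeriv ((chartAt E x ∘ e.symm) ∘ (e ∘ (chartAt E x).symm)) (chartAt E x x) v
        (L2 (L1 v)) :=
      HasDirDeriv.comp_crNear (r := ⊤) (by rwa [e1]) le_top (by rwa [e1]) (hL1 v)
    refine this.unique ((HasDirDeriv.clm (.id ℝ E) _ v).congr_of_eventuallyEq ?_)
    filter_upwards [eventually_chart_symm hc (e.open_source.mem_nhds hx)] with w ⟨hw, hw'⟩
    have hw' : (chartAt E x).symm w ∈ e.source := hw'
    simp [hw, hw']

theorem IsCrMap.crNear_lie {f : G →* G'} (hf : IsCrMap E F ⊤ f) :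
    CrNear ⊤ (chartAt F (1 : G') ∘ f ∘ (chartAt E (1 : G)).symm) (chartAt E (1 : G) 1) := by
  have := (hf.mCrAt 1).2
  rwa [map_one] at this

theorem IsCrMap.exists_lieMap {f : G →* G'} (hf : IsCrMap E F ⊤ f) :
    ∃ L : E →L[ℝ] F, ⇑L = lieMap E F f ∧ ∀ v, HasDirDeriv
      (chartAt F (1 : G') ∘ f ∘ (chartAt E (1 : G)).symm) (chartAt E (1 : G) 1) v (L v) := by
  obtain ⟨L, hL⟩ := hf.crNear_lie.exists_clm le_top
  exact ⟨L, funext fun v => ((hL v).dirDeriv_eq).symm, hL⟩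

theorem lieMap_id : lieMap E E (MonoidHom.id G) = id := by
  funext v
  refine ((HasDirDeriv.clm (.id ℝ E) (chartAt E (1 : G) 1) v).congr_of_eventuallyEq
    ?_).dirDeriv_eq
  filter_upwards [(chartAt E (1 : G)).open_target.mem_nhds (mem_chart_target E 1)] with w hw
  simp [hw]

theorem lieMap_comp {g : G' →* G''} (hg : IsCrMap F H ⊤ g) {f : G →* G'} (hf : IsCrMap E F ⊤ f) :
    lieMap E H (g.comp f) = lieMap F H g ∘ lieMap E F f := by
  obtain ⟨Lg, hLg, hLg'⟩ := hg.exists_lieMap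
  obtain ⟨Lf, hLf, hLf'⟩ := hf.exists_lieMap
  rw [← hLg, ← hLf]
  funext v
  have e1 : (chartAt F (1 : G') ∘ f ∘ (chartAt E (1 : G)).symm) (chartAt E (1 : G) 1) =
    chartAt F (1 : G') 1 := by simp
  have := HasDirDeriv.comp_crNear (r := ⊤) (by rw [e1]; exact hg.crNear_lie) le_top
    (by rwa [e1]) (hLf' v)
  refine (this.congr_of_eventuallyEq ?_).dirDeriv_eq
  have hs : ∀ᶠ z in 𝓝 (1 : G), f z ∈ (chartAt F (1 : G')).source := by
    refine (hf.1.tendsto 1).eventually ?_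
    rw [map_one]
    exact chart_source_mem_nhds F 1
  filter_upwards [eventually_chart_symm (mem_chart_source E (1 : G)) hs] with w ⟨_, hw⟩
  simp [hw]

end LieGroup

/-! ### Adapted charts of an ascending union -/

section Adapted

variable {En : ℕ → Type u} [∀ n, AddCommGroup (En n)] [∀ n, Module ℝ (En n)]
  [∀ n, TopologicalSpace (En n)] [∀ n, IsTopologicalAddGroup (En n)]
  [∀ n, ContinuousSMul ℝ (En n)] [∀ n, LocallyConvexSpace ℝ (En n)] [∀ n, T2Space (En n)]
  {E : Type u} [AddCommGroup E] [Module ℝ E] [TopologicalSpace E] [IsTopologicalAddGroup E]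
  [ContinuousSMul ℝ E] [LocallyConvexSpace ℝ E] [T2Space E]
  {Gn : ℕ → Type u} [∀ n, Group (Gn n)] [∀ n, TopologicalSpace (Gn n)]
  [∀ n, ChartedSpace (En n) (Gn n)]
  {G : Type u} [Group G] [TopologicalSpace G] [ChartedSpace E G]

/-- A chart `φ` of `G` around `1` with `φ 1 = 0` and charts `φ_n` of the groups `G_n` such that
`φ ∘ ι_n = J_n ∘ φ_n`, where the linear maps `J_n` are injective for `n ≥ N` and the ranges of the
`J_n` cover `E`. -/
structure AdaptedCharts (b : ∀ ⦃m n : ℕ⦄, m ≤ n → Gn m →* Gn n) (ι : ∀ n, Gn n →* G)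
    (J : ∀ n, En n →L[ℝ] E) (N : ℕ) (φ : OpenPartialHomeomorph G E)
    (φn : ∀ n, N ≤ n → OpenPartialHomeomorph (Gn n) (En n)) : Prop where
  isCrChart : IsCrChart ⊤ φ
  isCrChart_step : ∀ n hn, IsCrChart ⊤ (φn n hn)
  one_mem : 1 ∈ φ.source
  map_one : φ 1 = 0
  mem_source : ∀ n hn, ∀ x ∈ (φn n hn).source, ι n x ∈ φ.source
  map_incl : ∀ n hn, ∀ x ∈ (φn n hn).source, φ (ι n x) = J n (φn n hn x)
  exists_mem : ∀ g ∈ φ.source, ∃ n hn, ∃ x ∈ (φn n hn).source, ι n x = g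
  map_step : ∀ m n (h : m ≤ n) hm hn, ∀ x ∈ (φn m hm).source, b h x ∈ (φn n hn).source
  injective : ∀ n, N ≤ n → Function.Injective (J n)
  exhaust : ∀ v, ∃ n, ∃ w, J n w = v

/-- In the charts `f` is `J`, so `J` has no nonzero kernel vector in the `0`-neighbourhood
`e.target`; any kernel vector can be scaled into it. -/
theorem injective_of_comp_chart {E F : Type*} [AddCommGroup E] [Module ℝ E] [TopologicalSpace E]
    [ContinuousSMul ℝ E] [AddCommGroup F] [Module ℝ F]
    [TopologicalSpace F] {M N : Type*} [TopologicalSpace M] [TopologicalSpace N]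
    {e : OpenPartialHomeomorph M E} {e' : OpenPartialHomeomorph N F} {f : M → N}
    (hf : Function.Injective f) (J : E →L[ℝ] F) (hs : ∀ x ∈ e.source, f x ∈ e'.source)
    (h : ∀ x ∈ e.source, e' (f x) = J (e x)) {x : M} (hx : x ∈ e.source) (h0 : e x = 0) :
    Function.Injective J := by
  have inj : ∀ v ∈ e.target, J v = 0 → v = 0 := by
    intro v hv hJ
    have h1 : e' (f (e.symm v)) = e' (f x) := by
      rw [h _ (e.map_target hv), h x hx, h0, map_zero, e.right_inv hv, hJ]
    have h2 := hf (e'.injOn (hs _ (e.map_target hv)) (hs x hx) h1)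
    rw [← e.right_inv hv, h2, h0]
  refine (injective_iff_map_eq_zero J).2 fun w hw => ?_
  have hc : Tendsto (fun t : ℝ => t • w) (𝓝[≠] 0) (𝓝 0) := by
    have : Continuous fun t : ℝ => t • w := by fun_prop
    simpa using (this.tendsto 0).mono_left nhdsWithin_le_nhds
  have ht : e.target ∈ 𝓝 (0 : E) := e.open_target.mem_nhds (h0 ▸ e.map_source hx)
  obtain ⟨t, ht, ht0⟩ := ((hc.eventually ht).and self_mem_nhdsWithin).exists
  have := inj _ ht (by rw [map_smul, hw, smul_zero])
  exact (smul_eq_zero.1 this).resolve_left ht0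

/-- The affine homeomorphism `v ↦ A (v - a)`. -/
def affineHomeomorph {E : Type*} [AddCommGroup E] [Module ℝ E] [TopologicalSpace E]
    [IsTopologicalAddGroup E] (A : E ≃L[ℝ] E) (a : E) : E ≃ₜ E :=
  (Homeomorph.addRight (-a)).trans A.toHomeomorph

theorem IsCrChart.transAffine {M : Type*} [TopologicalSpace M] [ChartedSpace E M] {r : ℕ∞}
    {e : OpenPartialHomeomorph M E} (he : IsCrChart r e) (A : E ≃L[ℝ] E) (a : E) :
    IsCrChart r (e.transHomeomorph (affineHomeomorph A a)) := by
  refine he.transHomeomorph _ (fun v => ?_) (fun v => ?_)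
  · exact CrNear.comp (g := A) (f := fun v => v + -a) (CrNear.clm (A : E →L[ℝ] E) _)
      ((CrNear.id v).add (CrNear.const _ _))
  · exact CrNear.add (f := A.symm) (g := fun _ => - -a) (CrNear.clm (A.symm : E →L[ℝ] E) _)
      (CrNear.const _ _)

/-- Normalisation of compatible charts, such that the linear maps `j_n` become the tangent maps of
the inclusions. -/
theorem exists_adaptedCharts_of_compatible {b : ∀ ⦃m n : ℕ⦄, m ≤ n → Gn m →* Gn n}
    {ι : ∀ n, Gn n →* G}
    (hG : IsAscendingUnion En E b ι) {J : ∀ n, En n →L[ℝ] E}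
    (hJ : ∀ n, ⇑(J n) = lieMap (En n) E (ι n))
    {φ : OpenPartialHomeomorph G E} (hφ : IsCrChart ⊤ φ) (h1 : 1 ∈ φ.source) {N : ℕ}
    {j : ∀ n, N ≤ n → En n →L[ℝ] E} (hj : ∀ v, ∃ n hn, ∃ w, j n hn w = v)
    {ψ : ∀ n, N ≤ n → OpenPartialHomeomorph (Gn n) (En n)}
    (hψ : ∀ n hn, IsCrChart ⊤ (ψ n hn)) (hone : ∀ n hn, 1 ∈ (ψ n hn).source)
    (hmem : ∀ n hn, ∀ x ∈ (ψ n hn).source, ι n x ∈ φ.source)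
    (hcomm : ∀ n hn, ∀ x ∈ (ψ n hn).source, φ (ι n x) = j n hn (ψ n hn x))
    (hex : ∀ g ∈ φ.source, ∃ n hn, ∃ x ∈ (ψ n hn).source, ι n x = g)
    (hstep : ∀ m n (h : m ≤ n) hm hn, ∀ x ∈ (ψ m hm).source, b h x ∈ (ψ n hn).source) :
    ∃ (φ' : OpenPartialHomeomorph G E)
      (ψ' : ∀ n, N ≤ n → OpenPartialHomeomorph (Gn n) (En n)), AdaptedCharts b ι J N φ' ψ' := by
  -- `A` and `An` are the differentials at `1` of the changes to the preferred charts; composing `v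
  -- ↦ A (v - φ 1)` with `φ`, and likewise for `ψ n`, turns `j n` into `J n`.
  obtain ⟨A, hA⟩ := exists_clequiv_chart_change hφ h1
  choose An hAn using fun n hn => exists_clequiv_chart_change (hψ n hn) (hone n hn)
  -- Both sides are the derivative at `ψ n 1` of `ι n`, read in `ψ n` and the preferred chart of
  -- `G`; near that point this map is also the chart change after `j n`.
  have hJA : ∀ n (hn : N ≤ n) v, J n (An n hn v) = A (j n hn v) := by
    intro n hn v
    obtain ⟨L, hL, hL'⟩ := (hG.smooth_incl n).exists_lieMap
    rw [hJ, ← hL]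
    have h1n := hone n hn
    have e1 : (chartAt (En n) (1 : Gn n) ∘ (ψ n hn).symm) (ψ n hn 1) =
        chartAt (En n) (1 : Gn n) 1 := by simp [h1n]
    have d1 := HasDirDeriv.comp_crNear (r := ⊤)
      (g := chartAt E (1 : G) ∘ ι n ∘ (chartAt (En n) (1 : Gn n)).symm)
      (by rw [e1]; exact (hG.smooth_incl n).crNear_lie) le_top (by rwa [e1]) (hAn n hn v)
    have e2 : j n hn (ψ n hn 1) = φ 1 := by rw [← hcomm n hn 1 h1n, map_one]
    have d2 := HasDirDeriv.comp_crNear (r := ⊤) (g := chartAt E (1 : G) ∘ φ.symm)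
      (f := j n hn) (x := ψ n hn 1) (v := v) (L := A)
      (by rw [e2]; exact hφ.crNear_symm (chart_mem_atlas E 1) h1 (mem_chart_source E 1)) le_top
      (by rw [e2]; exact hA) (.clm _ _ _)
    refine d1.unique (d2.congr_of_eventuallyEq ?_)
    filter_upwards [eventually_chart_symm h1n (chart_source_mem_nhds (En n) (1 : Gn n))]
      with w ⟨hw, hw'⟩
    have hw' : (ψ n hn).symm w ∈ (chartAt (En n) (1 : Gn n)).source := hw'
    have h3 := hcomm n hn _ ((ψ n hn).map_target hw)
    rw [(ψ n hn).right_inv hw] at h3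
    simp only [Function.comp_apply, (chartAt (En n) (1 : Gn n)).left_inv hw', ← h3]
    rw [φ.left_inv (hmem n hn _ ((ψ n hn).map_target hw))]
  have hcomm' : ∀ n (hn : N ≤ n), ∀ x ∈ (ψ n hn).source,
      φ.transHomeomorph (affineHomeomorph A (φ 1)) (ι n x) =
        J n ((ψ n hn).transHomeomorph (affineHomeomorph (An n hn) (ψ n hn 1)) x) := by
    intro n hn x hx
    change A (φ (ι n x) + -φ 1) = J n (An n hn (ψ n hn x + -ψ n hn 1))
    rw [hJA, hcomm n hn x hx, map_add (j n hn), map_neg (j n hn), ← hcomm n hn 1 (hone n hn),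
      map_one]
  refine ⟨φ.transHomeomorph (affineHomeomorph A (φ 1)), fun n hn =>
    (ψ n hn).transHomeomorph (affineHomeomorph (An n hn) (ψ n hn 1)),
    hφ.transAffine _ _, fun n hn => (hψ n hn).transAffine _ _, h1, ?_, hmem, hcomm', hex,
    hstep, ?_, ?_⟩
  · change A (φ 1 + -φ 1) = 0
    simp
  · intro n hn
    refine injective_of_comp_chart
      (e := (ψ n hn).transHomeomorph (affineHomeomorph (An n hn) (ψ n hn 1)))
      (e' := φ.transHomeomorph (affineHomeomorph A (φ 1))) (hG.injective n) (J n) (hmem n hn)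
      (hcomm' n hn) (hone n hn) ?_
    change An n hn (ψ n hn 1 + -ψ n hn 1) = 0
    simp
  · intro v
    obtain ⟨n, hn, w, hw⟩ := hj (A.symm v)
    exact ⟨n, An n hn w, by rw [hJA, hw, A.apply_symm_apply]⟩

theorem exists_adaptedCharts {b : ∀ ⦃m n : ℕ⦄, m ≤ n → Gn m →* Gn n} {ι : ∀ n, Gn n →* G}
    (hG : IsAscendingUnion En E b ι) (hchart : AdmitsDirectLimitChart (En := En) (E := E) b ι)
    {J : ∀ n, En n →L[ℝ] E} (hJ : ∀ n, ⇑(J n) = lieMap (En n) E (ι n)) :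
    ∃ (N : ℕ) (φ : OpenPartialHomeomorph G E)
      (φn : ∀ n, N ≤ n → OpenPartialHomeomorph (Gn n) (En n)), AdaptedCharts b ι J N φ φn := by
  obtain ⟨φ, h1, hφ, n₀, jb, j, φn, hj, hjs, hφn, hsrc, -, hU, -, hcomm⟩ := hchart
  have hmem : ∀ n : Ici n₀, ∀ x ∈ (φn n).source, ι n x ∈ φ.source := fun n x hx => by
    rw [hU]
    exact mem_iUnion.2 ⟨n, mem_image_of_mem _ hx⟩
  -- The charts of the steps need not contain `1` from `n₀` on; `N` is an index where one does, and
  -- then all later ones do.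
  obtain ⟨⟨N, hN⟩, x, hx, hx1⟩ := mem_iUnion.1 (hU ▸ h1)
  have hN' : n₀ ≤ N := hN
  obtain rfl : x = 1 := hG.injective _ (hx1.trans (map_one _).symm)
  refine ⟨N, exists_adaptedCharts_of_compatible hG hJ hφ h1
    (j := fun n hn => j ⟨n, hN'.trans hn⟩) (ψ := fun n hn => φn ⟨n, hN'.trans hn⟩) ?_
    (fun n hn => hφn _) (fun n hn => ?_) (fun n hn => hmem ⟨n, hN'.trans hn⟩)
    (fun n hn => hcomm ⟨n, hN'.trans hn⟩) (fun g hg => ?_) (fun m n h hm hn x hx => ?_)⟩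
  · intro v
    obtain ⟨⟨n, hn⟩, w, hw⟩ := hjs v
    refine ⟨max N n, le_max_left _ _, jb (m := ⟨n, hn⟩)
      (n := ⟨max N n, hN'.trans (le_max_left _ _)⟩) (le_max_right N n) w, ?_⟩
    rw [hj.cone, hw]
  · simpa using hsrc (m := ⟨N, hN⟩) (n := ⟨n, hN'.trans hn⟩) hn hx
  · obtain ⟨⟨n, hn⟩, x, hx, rfl⟩ := mem_iUnion.1 (hU ▸ hg : g ∈ _)
    refine ⟨max N n, le_max_left _ _, b (le_max_right _ _) x, ?_, hG.comp _ _⟩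
    exact hsrc (m := ⟨n, hn⟩) (n := ⟨max N n, hN'.trans (le_max_left _ _)⟩) (le_max_right N n) hx
  · exact hsrc (m := ⟨m, hN'.trans hm⟩) (n := ⟨n, hN'.trans hn⟩) h hx

end Adapted

/-! ### Cut-off functions -/

section CutOff

variable {E : Type*} [AddCommGroup E] [Module ℝ E] [TopologicalSpace E]
  [IsTopologicalAddGroup E] [ContinuousSMul ℝ E]

/-- Every locally convex space is `C^0`-regular. -/
theorem isCrRegular_zero : IsCrRegular E 0 := by
  intro U hU
  -- The uniform structure of the additive group makes `E` completely regular.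
  let _ : UniformSpace E := IsTopologicalAddGroup.rightUniformSpace E
  obtain ⟨f, hf, hf0, hf1⟩ := CompletelyRegularSpace.completely_regular (0 : E)
    (interior U)ᶜ isOpen_interior.isClosed_compl (by simpa using mem_interior_iff_mem_nhds.2 hU)
  refine ⟨fun x => 1 - (f x : ℝ), RecCr.isCrOn isOpen_univ fun n hn => ?_, by simp [hf0],
    fun x hx => ?_⟩
  · obtain rfl : n = 0 := by simpa using hn
    exact (by fun_prop : Continuous fun x => 1 - (f x : ℝ)).continuousOn
  · have : f x = 1 := hf1 fun h => hx (interior_subset h)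
    simp [this]

/-- Regularity only gives the value `1` at the point `0`. Being `1` near `0` makes `Θ ∘ T` a local
identity, and values in `[0, 1]` keep `χ v • v` inside convex sets. -/
theorem IsCrRegular.exists_cutoff {r : ℕ∞} (h : IsCrRegular E r) {U : Set E} (hU : U ∈ 𝓝 0) :
    ∃ χ : E → ℝ, (∀ x, CrNear r χ x) ∧ (∀ᶠ x in 𝓝 0, χ x = 1) ∧ (∀ x, χ x ∈ Icc (0 : ℝ) 1) ∧
      ∃ K, IsClosed K ∧ K ⊆ U ∧ ∀ x ∉ K, χ x = 0 := by
  obtain ⟨f, hf, hf0, hf1⟩ := h U hU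
  have hfn : ∀ x, CrNear r f x := fun x => hf.crNear isOpen_univ trivial
  have hfc : Continuous f := continuous_iff_continuousAt.2 fun x => (hfn x).continuousAt
  -- The smooth step is `0` where `f ≤ 1/3` and `1` where `f ≥ 2/3`.
  refine ⟨fun x => Real.smoothTransition (3 * f x - 1), fun x => ?_, ?_,
    fun x => ⟨Real.smoothTransition.nonneg _, Real.smoothTransition.le_one _⟩,
    {x | 1 / 3 ≤ f x}, isClosed_le continuous_const hfc, fun x hx => ?_, fun x hx => ?_⟩
  · exact CrNear.comp (g := fun t : ℝ => Real.smoothTransition (3 * t - 1)) (f := f)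
      (CrNear.of_contDiff (fun n => Real.smoothTransition.contDiff.comp (by fun_prop)) _) (hfn x)
  · have : ∀ᶠ x in 𝓝 0, f x ∈ Ioi (2 / 3 : ℝ) :=
      hfc.continuousAt.eventually (isOpen_Ioi.mem_nhds (by rw [hf0]; norm_num))
    filter_upwards [this] with x hx
    have hx : 2 / 3 < f x := hx
    exact Real.smoothTransition.one_of_one_le (by linarith)
  · by_contra hxU
    have hx : 1 / 3 ≤ f x := hx
    rw [hf1 x hxU] at hx
    norm_num at hx
  · have hx : ¬ 1 / 3 ≤ f x := hx
    exact Real.smoothTransition.zero_of_nonpos (by linarith)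

end CutOff

/-! ### Transfer of direct limit properties -/

section Transfer

variable {A : ℕ → Type u} [∀ n, AddCommGroup (A n)] [∀ n, Module ℝ (A n)]
  [∀ n, TopologicalSpace (A n)] [∀ n, IsTopologicalAddGroup (A n)]
  [∀ n, ContinuousSMul ℝ (A n)] [∀ n, LocallyConvexSpace ℝ (A n)] [∀ n, T2Space (A n)]
  {A' : Type u} [AddCommGroup A'] [Module ℝ A'] [TopologicalSpace A'] [IsTopologicalAddGroup A']
  [ContinuousSMul ℝ A'] [LocallyConvexSpace ℝ A'] [T2Space A']
  {X Y : ℕ → Type u} [∀ n, TopologicalSpace (X n)] [∀ n, ChartedSpace (A n) (X n)]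
  [∀ n, TopologicalSpace (Y n)] [∀ n, ChartedSpace (A n) (Y n)]
  {X' Y' : Type u} [TopologicalSpace X'] [ChartedSpace A' X']
  [TopologicalSpace Y'] [ChartedSpace A' Y']
  {bX : ∀ ⦃m n : ℕ⦄, m ≤ n → X m → X n} {ιX : ∀ n, X n → X'}
  {bY : ∀ ⦃m n : ℕ⦄, m ≤ n → Y m → Y n} {ιY : ∀ n, Y n → Y'}

/-- The set `Y'` is the direct limit of the sets `Y n`. -/
structure IsSetLimit (bY : ∀ ⦃m n : ℕ⦄, m ≤ n → Y m → Y n) (ιY : ∀ n, Y n → Y') : Prop where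
  directedSystem : DirectedSystem Y bY
  cone : ∀ ⦃m n : ℕ⦄ (h : m ≤ n) (x : Y m), ιY n (bY h x) = ιY m x
  surj : ∀ y, ∃ n x, ιY n x = y
  inj : ∃ N, ∀ n, N ≤ n → Function.Injective (ιY n)

/-- Two representatives of one point agree at any common later stage past `N`, where the maps `ιY`
are injective. -/
theorem IsSetLimit.exists_lift (hY : IsSetLimit bY ιY) {Z : Type*} {ψ : ∀ n, Y n → Z}
    (hψ : ∀ ⦃m n : ℕ⦄ (h : m ≤ n) (x : Y m), ψ n (bY h x) = ψ m x) :
    ∃ f : Y' → Z, ∀ n x, f (ιY n x) = ψ n x := by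
  choose k p hp using hY.surj
  obtain ⟨N, hN⟩ := hY.inj
  refine ⟨fun y => ψ (k y) (p y), fun n x => ?_⟩
  set m := max N (max n (k (ιY n x)))
  have h1 : n ≤ m := (le_max_left _ _).trans (le_max_right _ _)
  have h2 : k (ιY n x) ≤ m := (le_max_right _ _).trans (le_max_right _ _)
  have h3 : bY h2 (p (ιY n x)) = bY h1 x :=
    hN m (le_max_left _ _) (by rw [hY.cone, hY.cone, hp])
  change ψ (k (ιY n x)) (p (ιY n x)) = ψ n x
  rw [← hψ h2, h3, hψ]

theorem IsSetLimit.funext (hY : IsSetLimit bY ιY) {Z : Type*} {f g : Y' → Z}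
    (h : ∀ n x, f (ιY n x) = g (ιY n x)) : f = g := by
  funext y
  obtain ⟨n, x, rfl⟩ := hY.surj y
  exact h n x

variable (A A') in
/-- Locally, `Y'` is a `C^r`-retract of `X'`, by means of maps which are compatible with the two
direct systems. -/
def LocallyFactors (r : ℕ∞) (bX : ∀ ⦃m n : ℕ⦄, m ≤ n → X m → X n) (ιX : ∀ n, X n → X')
    (ιY : ∀ n, Y n → Y') : Prop :=
  ∀ y₀ : Y', ∃ (Θ : X' → Y') (T : Y' → X'), MCrAt A' A' r T y₀ ∧ (∀ᶠ y in 𝓝 y₀, Θ (T y) = y) ∧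
    ∀ n (x : X n), ∃ (m : ℕ) (h : n ≤ m) (s : X m → Y m), MCrAt (A m) (A m) r s (bX h x) ∧
      ∀ᶠ x' in 𝓝 (bX h x), Θ (ιX m x') = ιY m (s x')

/-- For the induced map `f`, each `f ∘ Θ ∘ ιX n` is locally `ψ m ∘ s` after a bonding map, hence
continuous. The universal property of `X'` makes `f ∘ Θ` continuous, and `f = (f ∘ Θ) ∘ T` near
`y₀`. -/
theorem LocallyFactors.isDirectLimitTop (hf : LocallyFactors A A' 0 bX ιX ιY)
    (hX : IsSetLimit bX ιX) (hY : IsSetLimit bY ιY)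
    (hb : ∀ ⦃m n : ℕ⦄ (h : m ≤ n), Continuous (bY h)) (hι : ∀ n, Continuous (ιY n))
    (h : IsDirectLimitTop bX ιX) : IsDirectLimitTop bY ιY := by
  refine ⟨hY.directedSystem, hb, hι, hY.cone, fun Z _ ψ hψ hψb => ?_⟩
  obtain ⟨f, hfψ⟩ := hY.exists_lift hψb
  refine ⟨f, ⟨continuous_iff_continuousAt.2 fun y₀ => ?_, hfψ⟩, fun g hg =>
    hY.funext fun n x => (hg.2 n x).trans (hfψ n x).symm⟩
  obtain ⟨Θ, T, hT, hΘT, hs⟩ := hf y₀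
  have hc : ∀ n, Continuous fun x => f (Θ (ιX n x)) := by
    refine fun n => continuous_iff_continuousAt.2 fun x => ?_
    obtain ⟨m, hm, s, hs, hse⟩ := hs n x
    have h1 : ContinuousAt (fun x' => f (Θ (ιX m x'))) (bX hm x) := by
      refine ((hψ m).continuousAt.comp hs.continuousAt).congr ?_
      filter_upwards [hse] with x' hx'
      simp [hx', hfψ]
    have h2 := ContinuousAt.comp h1 (h.continuous_bond hm).continuousAt
    simpa only [Function.comp_def, h.cone] using h2
  obtain ⟨k, ⟨hk, hk'⟩, -⟩ := h.universal Z _ hc fun m n hmn x => by rw [h.cone]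
  obtain rfl : k = f ∘ Θ := hX.funext hk'
  refine (ContinuousAt.comp (g := f ∘ Θ) hk.continuousAt hT.continuousAt).congr ?_
  filter_upwards [hΘT] with y hy
  simp [hy]

theorem LocallyFactors.isDirectLimitMfd {r : ℕ∞} (hf : LocallyFactors A A' r bX ιX ιY)
    (hX : IsSetLimit bX ιX) (hY : IsSetLimit bY ιY) (hXn : ∀ n, IsCrManifold (A n) r (X n))
    (hY' : IsCrManifold A' r Y')
    (hb : ∀ ⦃m n : ℕ⦄ (h : m ≤ n), IsCrMap (A m) (A n) r (bY h))
    (hι : ∀ n, IsCrMap (A n) A' r (ιY n))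
    (h : IsDirectLimitMfd r A A' bX ιX) : IsDirectLimitMfd r A A' bY ιY := by
  refine ⟨hY.directedSystem, hb, hι, hY.cone, fun F _ _ _ _ _ _ _ Z _ _ hZ ψ hψ hψb => ?_⟩
  obtain ⟨f, hfψ⟩ := hY.exists_lift hψb
  refine ⟨f, ⟨isCrMap_of_mCrAt hY' hZ fun y₀ => ?_, hfψ⟩, fun g hg =>
    hY.funext fun n x => (hg.2 n x).trans (hfψ n x).symm⟩
  obtain ⟨Θ, T, hT, hΘT, hs⟩ := hf y₀
  have hc : ∀ n, IsCrMap (A n) F r fun x => f (Θ (ιX n x)) := by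
    refine fun n => isCrMap_of_mCrAt (hXn n) hZ fun x => ?_
    obtain ⟨m, hm, s, hs, hse⟩ := hs n x
    have h1 : MCrAt (A m) F r (fun x' => f (Θ (ιX m x'))) (bX hm x) := by
      refine (((hψ m).mCrAt _).comp hs).congr ?_
      filter_upwards [hse] with x' hx'
      simp [hx', hfψ]
    have h2 := h1.comp ((h.isCrMap_bond hm).mCrAt x)
    simpa only [Function.comp_def, h.cone] using h2
  obtain ⟨k, ⟨hk, hk'⟩, -⟩ := h.universal F Z hZ _ hc fun m n hmn x => by rw [h.cone]
  -- The map supplied by the universal property agrees with `f ∘ Θ` on the images of all steps,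
  -- which cover `X'`.
  obtain rfl : k = f ∘ Θ := hX.funext hk'
  refine ((hk.mCrAt _).comp hT).congr ?_
  filter_upwards [hΘT] with y hy
  simp [hy]

end Transfer

/-! ### Passage between the Lie group and its Lie algebra -/

section Passage

variable {En : ℕ → Type u} [∀ n, AddCommGroup (En n)] [∀ n, Module ℝ (En n)]
  [∀ n, TopologicalSpace (En n)] [∀ n, IsTopologicalAddGroup (En n)]
  [∀ n, ContinuousSMul ℝ (En n)] [∀ n, LocallyConvexSpace ℝ (En n)] [∀ n, T2Space (En n)]
  {E : Type u} [AddCommGroup E] [Module ℝ E] [TopologicalSpace E] [IsTopologicalAddGroup E]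
  [ContinuousSMul ℝ E] [LocallyConvexSpace ℝ E] [T2Space E]
  {Gn : ℕ → Type u} [∀ n, Group (Gn n)] [∀ n, TopologicalSpace (Gn n)]
  [∀ n, ChartedSpace (En n) (Gn n)]
  {G : Type u} [Group G] [TopologicalSpace G] [ChartedSpace E G]
  {b : ∀ ⦃m n : ℕ⦄, m ≤ n → Gn m →* Gn n} {ι : ∀ n, Gn n →* G}
  {J : ∀ n, En n →L[ℝ] E} {Jb : ∀ ⦃m n : ℕ⦄, m ≤ n → En m →L[ℝ] En n} {N : ℕ}
  {φ : OpenPartialHomeomorph G E} {φn : ∀ n, N ≤ n → OpenPartialHomeomorph (Gn n) (En n)}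
  {r : ℕ∞}

theorem IsAscendingUnion.bond_refl (hG : IsAscendingUnion En E b ι) {n : ℕ} (x : Gn n) :
    b le_rfl x = x :=
  hG.injective n (hG.comp _ _)

theorem IsAscendingUnion.bond_trans (hG : IsAscendingUnion En E b ι) {l m n : ℕ} (h : l ≤ m)
    (h' : m ≤ n) (x : Gn l) : b h' (b h x) = b (h.trans h') x :=
  hG.injective n (by rw [hG.comp, hG.comp, hG.comp])

theorem IsAscendingUnion.isSetLimit (hG : IsAscendingUnion En E b ι) :
    IsSetLimit (fun _ _ h => b h) (fun n => ι n) :=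
  ⟨⟨fun _ x => hG.bond_refl x, fun _ _ _ h h' x => hG.bond_trans h h' x⟩, hG.comp, hG.exhaust,
    0, fun n _ => hG.injective n⟩

theorem AdaptedCharts.locallyFactors_group (h : AdaptedCharts b ι J N φ φn)
    (hG : IsAscendingUnion En E b ι) (hJ : ∀ ⦃m n : ℕ⦄ (h : m ≤ n) x, J n (Jb h x) = J m x)
    (hr : IsCrRegular E r) :
    LocallyFactors En E r (fun _ _ h => Jb h) (fun n => J n) (fun n => ι n) := by
  intro g
  have h0 : φ.target ∈ 𝓝 (0 : E) :=
    φ.open_target.mem_nhds (h.map_one ▸ φ.map_source h.one_mem)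
  obtain ⟨S, ⟨hS, hSc⟩, hSφ⟩ := (LocallyConvexSpace.convex_basis (𝕜 := ℝ) (0 : E)).mem_iff.1 h0
  obtain ⟨χ, hχ, hχ1, hχI, K, -, hKS, hχ0⟩ := hr.exists_cutoff hS
  -- Convexity of `S` lets the factor `χ v ∈ [0, 1]` shrink `v ∈ S` towards `0` within `S`;
  -- elsewhere the product is `0`. So `φ.symm (χ v • v)` makes sense for every `v`.
  have hθ : ∀ v, χ v • v ∈ φ.target := by
    intro v
    refine hSφ ?_
    by_cases hv : v ∈ K
    · exact hSc.smul_mem_of_zero_mem (mem_of_mem_nhds hS) (hKS hv) (hχI v)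
    · rw [hχ0 v hv, zero_smul]
      exact mem_of_mem_nhds hS
  have hT : MCrAt E E ⊤ (fun y => φ (g⁻¹ * y)) g :=
    (h.isCrChart.mCrAt (x := g⁻¹ * g) (by simpa using h.one_mem)).comp
      (hG.isLieGroup.mCrAt_mul_left g⁻¹ g)
  refine ⟨fun v => g * φ.symm (χ v • v), fun y => φ (g⁻¹ * y), hT.mono_order le_top, ?_, ?_⟩
  · have h1 : ∀ᶠ y in 𝓝 g, χ (φ (g⁻¹ * y)) = 1 :=
      hT.continuousAt.eventually (by simpa [h.map_one] using hχ1)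
    have h2 : ∀ᶠ y in 𝓝 g, g⁻¹ * y ∈ φ.source :=
      (hG.isLieGroup.mCrAt_mul_left g⁻¹ g).continuousAt.eventually
        (φ.open_source.mem_nhds (by simpa using h.one_mem))
    filter_upwards [h1, h2] with y hy hy'
    simp [hy, hy']
  · intro n x
    -- The point `φ.symm (χ v • v)` for `v = J n x` comes from a chart domain of stage `n₁`, and `g`
    -- from stage `n₂`; at a stage `m` above both, `Θ` lifts.
    obtain ⟨n₁, hn₁, z, hz, hzp⟩ := h.exists_mem _ (φ.map_target (hθ (J n x)))
    obtain ⟨n₂, g₂, hg₂⟩ := hG.exhaust g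
    set m := max n (max n₁ n₂)
    have h1 : n₁ ≤ m := (le_max_left _ _).trans (le_max_right _ _)
    have h2 : n₂ ≤ m := (le_max_right _ _).trans (le_max_right _ _)
    have hm : N ≤ m := hn₁.trans h1
    have hnm : n ≤ m := le_max_left _ _
    have hc : ∀ w, CrNear r (fun w => χ (J m w) • w) w := fun w =>
      (CrNear.comp (f := J m) (hχ _) (CrNear.clm _ _)).smul (CrNear.id w)
    have hbz := h.map_step _ _ h1 hn₁ hm z hz
    -- This vector and `φn m` of the point found above have the same image under the injective map
    -- `J m`.
    have hmem : χ (J m (Jb hnm x)) • Jb hnm x ∈ (φn m hm).target := by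
      have : χ (J m (Jb hnm x)) • Jb hnm x = φn m hm (b h1 z) := by
        refine h.injective m hm ?_
        rw [← h.map_incl m hm _ hbz, hG.comp, hzp, φ.right_inv (hθ _), map_smul, hJ]
      rw [this]
      exact (φn m hm).map_source hbz
    refine ⟨m, hnm, fun w => b h2 g₂ * (φn m hm).symm (χ (J m w) • w), ?_, ?_⟩
    · exact (((hG.isLieGroup_step m).mCrAt_mul_left _ _).mono_order le_top).comp
        (f := fun w => (φn m hm).symm (χ (J m w) • w))
        (MCrAt.comp (((h.isCrChart_step m hm).mCrAt_symm hmem).mono_order le_top)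
          (mCrAt_iff_crNear.2 (hc _)))
    · filter_upwards [(hc (Jb hnm x)).continuousAt.eventually
        ((φn m hm).open_target.mem_nhds hmem)] with w hw
      have hw : χ (J m w) • w ∈ (φn m hm).target := hw
      have hs := (φn m hm).map_target hw
      have := h.map_incl m hm _ hs
      rw [(φn m hm).right_inv hw, map_smul] at this
      rw [map_mul, hG.comp, hg₂, ← this, φ.left_inv (h.mem_source m hm _ hs)]

open Classical in
theorem AdaptedCharts.locallyFactors_lieAlg (h : AdaptedCharts b ι J N φ φn)
    (hG : IsAscendingUnion En E b ι) (hJ : ∀ ⦃m n : ℕ⦄ (h : m ≤ n) x, J n (Jb h x) = J m x)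
    (hr : IsCrRegular E r) :
    LocallyFactors En E r (fun _ _ h => b h) (fun n => ι n) (fun n => J n) := by
  intro v₀
  have := hG.isLieGroup.isTopologicalGroup
  -- `C` is closed in all of `G`, not just in the chart domain. Since `χ ∘ φ` vanishes on the chart
  -- domain outside `C`, the extension by `v₀` is harmless at the boundary of that domain.
  obtain ⟨C, ⟨hC, hCc⟩, hCφ⟩ := (closed_nhds_basis (1 : G)).mem_iff.1
    (φ.open_source.mem_nhds h.one_mem)
  have hsymm0 : φ.symm 0 = 1 := by rw [← h.map_one, φ.left_inv h.one_mem]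
  have h0 : (0 : E) ∈ φ.target := h.map_one ▸ φ.map_source h.one_mem
  have hS : φ.symm ⁻¹' C ∈ 𝓝 (0 : E) :=
    (φ.continuousAt_symm h0).preimage_mem_nhds (by rwa [hsymm0])
  obtain ⟨χ, hχ, hχ1, -, K, -, hKS, hχ0⟩ := hr.exists_cutoff hS
  obtain ⟨n₀, w₀, hw₀⟩ := h.exhaust v₀
  have hT : MCrAt E E ⊤ (fun v => φ.symm (v + -v₀)) v₀ :=
    (h.isCrChart.mCrAt_symm (v := v₀ + -v₀) (by simpa using h0)).comp
      (f := fun v => v + -v₀) (mCrAt_iff_crNear.2 ((CrNear.id v₀).add (CrNear.const (-v₀) v₀)))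
  refine ⟨fun y => if y ∈ φ.source then v₀ + χ (φ y) • φ y else v₀, fun v => φ.symm (v + -v₀),
    hT.mono_order le_top, ?_, ?_⟩
  · have hc : Tendsto (fun v => v + -v₀) (𝓝 v₀) (𝓝 0) := by
      have : Continuous fun v => v + -v₀ := by fun_prop
      simpa using this.tendsto v₀
    filter_upwards [hc.eventually (φ.open_target.mem_nhds h0), hc.eventually hχ1] with v hv hv1
    have hv : v + -v₀ ∈ φ.target := hv
    rw [if_pos (φ.map_target hv), φ.right_inv hv, hv1, one_smul, add_neg_cancel_comm_assoc]
  · intro n x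
    -- Inside the chart domain, `Θ` is lifted through `φn m`, with `m` large enough that `v₀` also
    -- comes from stage `m`. Outside it, the point avoids `C`, so `Θ` is constantly `v₀` nearby.
    by_cases hx : ι n x ∈ φ.source
    · obtain ⟨n₁, hn₁, z, hz, hzx⟩ := h.exists_mem _ hx
      set m := max n (max n₁ n₀)
      have h1 : n₁ ≤ m := (le_max_left _ _).trans (le_max_right _ _)
      have h2 : n₀ ≤ m := (le_max_right _ _).trans (le_max_right _ _)
      have hm : N ≤ m := hn₁.trans h1
      have hnm : n ≤ m := le_max_left _ _
      have hbx : b hnm x ∈ (φn m hm).source := by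
        have : b hnm x = b h1 z := hG.injective m (by rw [hG.comp, hG.comp, hzx])
        rw [this]
        exact h.map_step _ _ h1 hn₁ hm z hz
      refine ⟨m, hnm, fun x' => Jb h2 w₀ + χ (J m (φn m hm x')) • φn m hm x', ?_, ?_⟩
      · have hc : ∀ w, CrNear r (fun w => Jb h2 w₀ + χ (J m w) • w) w := fun w =>
          (CrNear.const _ _).add
            ((CrNear.comp (f := J m) (hχ _) (CrNear.clm _ _)).smul (CrNear.id w))
        exact MCrAt.comp (g := fun w => Jb h2 w₀ + χ (J m w) • w) (mCrAt_iff_crNear.2 (hc _))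
          (((h.isCrChart_step m hm).mCrAt hbx).mono_order le_top)
      · filter_upwards [(φn m hm).open_source.mem_nhds hbx] with x' hx'
        rw [if_pos (h.mem_source m hm x' hx'), h.map_incl m hm x' hx', map_add, map_smul, hJ, hw₀]
    · set m := max n n₀
      have hnm : n ≤ m := le_max_left _ _
      refine ⟨m, hnm, fun _ => Jb (le_max_right n n₀) w₀, MCrAt.const _ _, ?_⟩
      have h1 : ∀ᶠ x' in 𝓝 (b hnm x), ι m x' ∉ C := by
        refine (hG.smooth_incl m).1.continuousAt.eventually (hCc.isOpen_compl.mem_nhds ?_)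
        rw [hG.comp]
        exact fun hxC => hx (hCφ hxC)
      filter_upwards [h1] with x' hx'
      rw [hJ, hw₀]
      split_ifs with hs
      · have : φ (ι m x') ∉ K := fun hK => hx' (by simpa [hs] using hKS hK)
        rw [hχ0 _ this, zero_smul, add_zero]
      · rfl

end Passage

end

end LCLie

/-! ### Both equivalences, from the local factorisations. -/

theorem theorem3p3
    {En : ℕ → Type u} [∀ n, AddCommGroup (En n)] [∀ n, Module ℝ (En n)]
    [∀ n, TopologicalSpace (En n)] [∀ n, IsTopologicalAddGroup (En n)]
    [∀ n, ContinuousSMul ℝ (En n)] [∀ n, LocallyConvexSpace ℝ (En n)] [∀ n, T2Space (En n)]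
    {E : Type u} [AddCommGroup E] [Module ℝ E] [TopologicalSpace E] [IsTopologicalAddGroup E]
    [ContinuousSMul ℝ E] [LocallyConvexSpace ℝ E] [T2Space E]
    {Gn : ℕ → Type u} [∀ n, Group (Gn n)] [∀ n, TopologicalSpace (Gn n)]
    [∀ n, ChartedSpace (En n) (Gn n)]
    {G : Type u} [Group G] [TopologicalSpace G] [ChartedSpace E G]
    (b : ∀ ⦃m n : ℕ⦄, m ≤ n → Gn m →* Gn n) (ι : ∀ n, Gn n →* G)
    (hG : LCLie.IsAscendingUnion En E b ι)
    (hchart : LCLie.AdmitsDirectLimitChart (En := En) (E := E) b ι) :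
    (LCLie.IsDirectLimitTop
        (X := fun n => LCLie.LieAlg (En n) (Gn n)) (Y := LCLie.LieAlg E G)
        (fun m n h => LCLie.lieMap (En m) (En n) (b h)) (fun n => LCLie.lieMap (En n) E (ι n)) ↔
      LCLie.IsDirectLimitTop (fun _ _ h => b h) (fun n => ι n)) ∧
    ∀ r : ℕ∞, LCLie.IsCrRegular (LCLie.LieAlg E G) r →
      (LCLie.IsDirectLimitMfd r En E
          (X := fun n => LCLie.LieAlg (En n) (Gn n)) (Y := LCLie.LieAlg E G)
          (fun m n h => LCLie.lieMap (En m) (En n) (b h)) (fun n => LCLie.lieMap (En n) E (ι n)) ↔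
        LCLie.IsDirectLimitMfd r En E (fun _ _ h => b h) (fun n => ι n)) := by
  choose J hJ _ using fun n => (hG.smooth_incl n).exists_lieMap
  choose Jb hJb _ using fun m n (h : m ≤ n) => (hG.smooth_bond h).exists_lieMap
  have hJJ : ∀ ⦃m n : ℕ⦄ (h : m ≤ n) x, J n (Jb m n h x) = J m x := fun m n h x => by
    have : (ι n).comp (b h) = ι m := MonoidHom.ext (hG.comp h)
    rw [hJ, hJ, hJb, ← this, LCLie.lieMap_comp (hG.smooth_incl n) (hG.smooth_bond h)]
    rfl
  obtain ⟨N, φ, φn, hφ⟩ := LCLie.exists_adaptedCharts hG hchart hJ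
  have hsetE : LCLie.IsSetLimit (fun m n h => Jb m n h) (fun n => J n) := by
    refine ⟨⟨fun n x => ?_, fun l m n h h' x => ?_⟩, hJJ, hφ.exhaust, N, hφ.injective⟩
    · have : b (le_refl n) = MonoidHom.id _ := MonoidHom.ext hG.bond_refl
      rw [hJb, this, LCLie.lieMap_id]
      rfl
    · have : (b h').comp (b h) = b (h.trans h') := MonoidHom.ext (hG.bond_trans h h')
      rw [hJb, hJb, hJb, ← this, LCLie.lieMap_comp (hG.smooth_bond h') (hG.smooth_bond h)]
      rfl
  have e1 : (fun m n h => LCLie.lieMap (En m) (En n) (b h)) = fun m n h => ⇑(Jb m n h) :=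
    funext fun m => funext fun n => funext fun h => (hJb m n h).symm
  have e2 : (fun n => LCLie.lieMap (En n) E (ι n)) = fun n => ⇑(J n) := funext fun n => (hJ n).symm
  rw [e1, e2]
  have hmfd : ∀ r, LCLie.IsCrManifold E r G := fun r => hG.isLieGroup.isManifold.mono_order le_top
  refine ⟨⟨fun h => ?_, fun h => ?_⟩, fun r hr => ⟨fun h => ?_, fun h => ?_⟩⟩
  -- The topological statement needs the factorisations only for `r = 0`, where regularity is
  -- automatic.
  · exact (hφ.locallyFactors_group hG hJJ LCLie.isCrRegular_zero).isDirectLimitTop hsetE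
      hG.isSetLimit (fun m n h => (hG.smooth_bond h).1) (fun n => (hG.smooth_incl n).1) h
  · exact (hφ.locallyFactors_lieAlg hG hJJ LCLie.isCrRegular_zero).isDirectLimitTop hG.isSetLimit
      hsetE (fun m n h => (Jb m n h).continuous) (fun n => (J n).continuous) h
  · exact (hφ.locallyFactors_group hG hJJ hr).isDirectLimitMfd hsetE hG.isSetLimit
      (fun n => LCLie.isCrManifold_self) (hmfd r)
      (fun m n h => (hG.smooth_bond h).mono_order le_top)
      (fun n => (hG.smooth_incl n).mono_order le_top) h
  · exact (hφ.locallyFactors_lieAlg hG hJJ hr).isDirectLimitMfd hG.isSetLimit hsetE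
      (fun n => (hG.isLieGroup_step n).isManifold.mono_order le_top) LCLie.isCrManifold_self
      (fun m n h => LCLie.isCrMap_of_mCrAt LCLie.isCrManifold_self LCLie.isCrManifold_self
        fun x => LCLie.mCrAt_iff_crNear.2 (LCLie.CrNear.clm _ x))
      (fun n => LCLie.isCrMap_of_mCrAt LCLie.isCrManifold_self LCLie.isCrManifold_self
        fun x => LCLie.mCrAt_iff_crNear.2 (LCLie.CrNear.clm _ x)) h
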